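/- **Setting.** Let $(\mathcal M,\otimes,\mathbf 1,\sigma)$ be an abelian symmetric monoidal category, i.e. a symmetric monoidal category which is abelian and such that the functors $X\otimes(-)$ and $(-)\otimes X$ are additive and exact for every object $X$. Let $\mathsf{Hopf}_{\mathrm{coc}}(\mathcal M)$ be the category of cocommutative Hopf monoids in $\mathcal M$ and bimonoid morphisms; it is pointed, with zero morphisms $u_B\varepsilon_A:A\to B$. For a Hopf monoid $A$, let $\mathsf{Comon}_{\mathrm{coc}}({}_A\mathcal M)$ be the category of cocommutative comonoids in the monoidal category of left $A$-modules (with diagonal action on tensor products). For a comonoid $Q$, a right $Q$-comodule $(V,\rho)$ and a left $Q$-comodule $(W,\lambda)$, let $e_{V,W}:V\square_Q W\to V\otimes W$ be the equalizer of $\rho\otimes \mathrm{Id}_W$ and $\mathrm{Id}_V\otimes\lambda$. A comonoid morphism $\pi:A\to Q$ makes $A$ a right and a left $Q$-comodule via $(\mathrm{Id}_A\otimes\pi)\Delta_A$ and $(\pi\otimes\mathrm{Id}_A)\Delta_A$. Assume that $\mathcal M$ satisfies the *faithful coflatness condition*: for every $A$ in $\mathsf{Hopf}_{\mathrm{coc}}(\mathcal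 M)$ and every morphism $\pi:A\to Q$ in $\mathsf{Comon}_{\mathrm{coc}}({}_A\mathcal M)$ (where $A$ has the regular left action) which is an epimorphism in $\mathcal M$, the functor $(-)\square_Q A$ from right $Q$-comodules to $\mathcal M$ preserves and reflects epimorphisms. **Statement.** (0) Let $f:A\to B$ be a morphism in $\mathsf{Hopf}_{\mathrm{coc}}(\mathcal M)$. Then $f$ has a kernel $k:K\to A$ in $\mathsf{Hopf}_{\mathrm{coc}}(\mathcal M)$, and the cokernel $\pi:=\mathsf{coker}(\mathsf{ker}(f)):A\to I$ in $\mathcal M$ of the kernel of $f$ in $\mathcal M$ is (for a suitable structure on $I$) a morphism in $\mathsf{Hopf}_{\mathrm{coc}}(\mathcal M)$. Moreover: - $\pi$ is the coequalizer in $\mathcal M$ of the two morphisms $(\varepsilon_A\otimes\mathrm{Id}_A)e_{A,A},\ (\mathrm{Id}_A\otimes\varepsilon_A)e_{A,A}:A\square_I A\to A$; - $\pi$ is the coequalizer in $\mathcal M$ of $m_A(\mathrm{Id}_A\otimes k),\ \mathrm{Id}_A\otimes\varepsilon_K:A\otimes K\to A$; - $\pi$ is the cokernel of $k$ in $\mathsf{Hopf}_{\mathrm{coc}}(\mathcal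 M)$; - $f=i\pi$ for a monomorphism $i:I\to B$ in $\mathsf{Hopf}_{\mathrm{coc}}(\mathcal M)$; in particular $f$ factorizes as a regular epimorphism (in fact, a cokernel) followed by a monomorphism in $\mathsf{Hopf}_{\mathrm{coc}}(\mathcal M)$. (1) A morphism in $\mathsf{Hopf}_{\mathrm{coc}}(\mathcal M)$ is a regular epimorphism in $\mathsf{Hopf}_{\mathrm{coc}}(\mathcal M)$ if and only if it is a cokernel in $\mathsf{Hopf}_{\mathrm{coc}}(\mathcal M)$, if and only if it is an epimorphism in $\mathcal M$. (2) A morphism in $\mathsf{Hopf}_{\mathrm{coc}}(\mathcal M)$ is a monomorphism in $\mathsf{Hopf}_{\mathrm{coc}}(\mathcal M)$ if and only if it is a monomorphism in $\mathcal M$. -/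

import Mathlib

open CategoryTheory MonoidalCategory Limits
open scoped MonObj ComonObj ModObj

universe v u

/-! ### Cocommutative Hopf monoids -/

section HopfCoc

variable (M : Type u) [Category.{v} M] [MonoidalCategory M] [BraidedCategory M]

/-- A cocommutative Hopf monoid in a braided monoidal category: a Hopf monoid whose
comultiplication is invariant under the braiding. -/
structure HopfCoc where
  /-- The underlying object. -/
  X : M
  [hopf : HopfObj X]
  [comm : IsCommComonObj X]

attribute [instance] HopfCoc.hopf HopfCoc.comm

namespace HopfCoc

variable {M}

/-- A morphism of cocommutative Hopf monoids is a morphism of the underlying bimonoids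
(such a morphism automatically commutes with the antipodes). -/
@[ext]
structure Hom (A B : HopfCoc M) where
  /-- The underlying morphism. -/
  hom : A.X ⟶ B.X
  [isBimonHom : IsBimonHom hom]

attribute [instance] Hom.isBimonHom

instance : Category (HopfCoc M) where
  Hom A B := Hom A B
  id A := { hom := 𝟙 A.X, isBimonHom := { } }
  comp f g := { hom := f.hom ≫ g.hom, isBimonHom := { } }

@[ext]
lemma hom_ext {A B : HopfCoc M} {f g : A ⟶ B} (h : f.hom = g.hom) : f = g :=
  Hom.ext h

@[simp]
lemma id_hom (A : HopfCoc M) : Hom.hom (𝟙 A) = 𝟙 A.X := rfl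

@[simp]
lemma comp_hom {A B C : HopfCoc M} (f : A ⟶ B) (g : B ⟶ C) :
    (f ≫ g).hom = f.hom ≫ g.hom := rfl

lemma isBimonHom_counit_unit (A B : HopfCoc M) : IsBimonHom (ε[A.X] ≫ η[B.X]) where
  one_hom := by rw [← Category.assoc, BimonObj.one_counit, Category.id_comp]
  mul_hom := by
    rw [← Category.assoc, BimonObj.mul_counit, Comon.tensorObj_counit,
      ← tensorHom_comp_tensorHom, Category.assoc, Category.assoc]
    congr 1
    rw [MonoidalCategory.tensorHom_def, Category.assoc, MonObj.mul_one, rightUnitor_naturality,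
      unitors_equal]
  hom_counit := by rw [Category.assoc, BimonObj.one_counit, Category.comp_id]
  hom_comul := by
    rw [Category.assoc, BimonObj.one_comul, MonObj.tensorObj.one_def,
      ← tensorHom_comp_tensorHom, ← Category.assoc, ← Category.assoc]
    congr 1
    rw [ComonObj.counit_comul_hom]

/-- The zero morphism `A ⟶ B` of cocommutative Hopf monoids is the counit of `A` followed by the
unit of `B`; it factors through the zero object, which is the unit object of `M`. -/
instance : HasZeroMorphisms (HopfCoc M) where
  zero A B := ⟨{ hom := ε[A.X] ≫ η[B.X], isBimonHom := isBimonHom_counit_unit A B }⟩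
  comp_zero {A B} f C := by
    apply hom_ext
    change f.hom ≫ ε[B.X] ≫ η[C.X] = ε[A.X] ≫ η[C.X]
    rw [IsComonHom.hom_counit_assoc]
  zero_comp A {B C} f := by
    apply hom_ext
    change (ε[A.X] ≫ η[B.X]) ≫ f.hom = ε[A.X] ≫ η[C.X]
    rw [Category.assoc, IsMonHom.one_hom]

end HopfCoc

end HopfCoc

/-! ### Comodules and the cotensor product -/

section Comodules

variable {M : Type u} [Category.{v} M] [MonoidalCategory M]

/-- A right comodule over a comonoid `Q`. -/
structure RightComod (Q : M) [ComonObj Q] where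
  /-- The underlying object. -/
  X : M
  /-- The right coaction. -/
  coact : X ⟶ X ⊗ Q
  coact_counit : coact ≫ X ◁ ε[Q] = (ρ_ X).inv
  coact_comul : coact ≫ X ◁ Δ[Q] = coact ≫ coact ▷ Q ≫ (α_ X Q Q).hom

/-- A left comodule over a comonoid `Q`. -/
structure LeftComod (Q : M) [ComonObj Q] where
  /-- The underlying object. -/
  X : M
  /-- The left coaction. -/
  coact : X ⟶ Q ⊗ X
  coact_counit : coact ≫ ε[Q] ▷ X = (λ_ X).inv
  coact_comul : coact ≫ Q ◁ coact = coact ≫ Δ[Q] ▷ X ≫ (α_ Q Q X).hom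

namespace RightComod

variable {Q : M} [ComonObj Q]

/-- A colinear morphism of right comodules. -/
@[ext]
structure Hom (V W : RightComod Q) where
  /-- The underlying morphism. -/
  hom : V.X ⟶ W.X
  hom_coact : hom ≫ W.coact = V.coact ≫ hom ▷ Q

instance : Category (RightComod Q) where
  Hom V W := Hom V W
  id V := { hom := 𝟙 V.X, hom_coact := by simp }
  comp f g :=
    { hom := f.hom ≫ g.hom
      hom_coact := by
        rw [Category.assoc, g.hom_coact, ← Category.assoc, f.hom_coact, Category.assoc,
          comp_whiskerRight] }

/-- A comonoid `A` as a right `Q`-comodule, through a comonoid morphism `p : A ⟶ Q`. -/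
def ofHom {A : M} [ComonObj A] (p : A ⟶ Q) [IsComonHom p] : RightComod Q where
  X := A
  coact := Δ[A] ≫ A ◁ p
  coact_counit := by
    rw [Category.assoc, ← whiskerLeft_comp, IsComonHom.hom_counit, ComonObj.comul_counit]
  coact_comul := by
    rw [Category.assoc, ← whiskerLeft_comp, IsComonHom.hom_comul,
      MonoidalCategory.tensorHom_def]
    simp only [whiskerLeft_comp, comp_whiskerRight, Category.assoc,
      ComonObj.comul_assoc_assoc, whisker_exchange_assoc, whisker_assoc,
      Iso.inv_hom_id, Category.comp_id]
    rw [associator_naturality_right_assoc, ← whiskerLeft_comp, ← whiskerLeft_comp,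
      whisker_exchange]

end RightComod

/-- A comonoid `A` as a left `Q`-comodule, through a comonoid morphism `p : A ⟶ Q`. -/
def LeftComod.ofHom {Q A : M} [ComonObj Q] [ComonObj A] (p : A ⟶ Q) [IsComonHom p] :
    LeftComod Q where
  X := A
  coact := Δ[A] ≫ p ▷ A
  coact_counit := by
    rw [Category.assoc, ← comp_whiskerRight, IsComonHom.hom_counit, ComonObj.counit_comul]
  coact_comul := by
    rw [Category.assoc, Category.assoc, ← comp_whiskerRight_assoc, IsComonHom.hom_comul,
      MonoidalCategory.tensorHom_def]
    simp only [whiskerLeft_comp, comp_whiskerRight, Category.assoc,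
      ← whisker_exchange_assoc, ComonObj.comul_assoc_assoc]
    simp

variable [HasEqualizers M] {Q : M} [ComonObj Q]

/-- The cotensor product `V □_Q W`, the equalizer of `V ⊗ W ⇉ V ⊗ (Q ⊗ W)`. -/
noncomputable def cotensor (V : RightComod Q) (W : LeftComod Q) : M :=
  equalizer (V.coact ▷ W.X ≫ (α_ V.X Q W.X).hom) (V.X ◁ W.coact)

/-- The canonical morphism `V □_Q W ⟶ V ⊗ W`. -/
noncomputable def cotensorι (V : RightComod Q) (W : LeftComod Q) :
    cotensor V W ⟶ V.X ⊗ W.X :=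
  equalizer.ι (V.coact ▷ W.X ≫ (α_ V.X Q W.X).hom) (V.X ◁ W.coact)

lemma cotensor_condition (V : RightComod Q) (W : LeftComod Q) :
    cotensorι V W ≫ V.coact ▷ W.X ≫ (α_ V.X Q W.X).hom = cotensorι V W ≫ V.X ◁ W.coact :=
  equalizer.condition _ _

lemma cotensor_hom_ext {V : RightComod Q} {W : LeftComod Q} {Z : M} {f g : Z ⟶ cotensor V W}
    (h : f ≫ cotensorι V W = g ≫ cotensorι V W) : f = g :=
  equalizer.hom_ext h

/-- The morphism into the cotensor product given by its universal property. -/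
noncomputable def cotensorLift (V : RightComod Q) (W : LeftComod Q) {Z : M}
    (f : Z ⟶ V.X ⊗ W.X)
    (h : f ≫ V.coact ▷ W.X ≫ (α_ V.X Q W.X).hom = f ≫ V.X ◁ W.coact) : Z ⟶ cotensor V W :=
  equalizer.lift f h

lemma cotensorLift_ι (V : RightComod Q) (W : LeftComod Q) {Z : M} (f : Z ⟶ V.X ⊗ W.X)
    (h : f ≫ V.coact ▷ W.X ≫ (α_ V.X Q W.X).hom = f ≫ V.X ◁ W.coact) :
    cotensorLift V W f h ≫ cotensorι V W = f :=
  equalizer.lift_ι _ _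

/-- The functor `(-) □_Q W` from right `Q`-comodules to `M`. On a colinear morphism `g` it is the
unique morphism compatible with `g ▷ W`. -/
noncomputable def cotensorFunctor (W : LeftComod Q) : RightComod Q ⥤ M where
  obj V := cotensor V W
  map {V V'} g := cotensorLift V' W (cotensorι V W ≫ g.hom ▷ W.X) (by
    have h := g.hom_coact
    rw [Category.assoc, ← comp_whiskerRight_assoc, h, comp_whiskerRight_assoc, Category.assoc,
      associator_naturality_left, ← whisker_exchange]
    simpa only [Category.assoc] using
      congrArg (fun t => t ≫ g.hom ▷ (Q ⊗ W.X)) (cotensor_condition V W))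
  map_id V := cotensor_hom_ext (by
    rw [cotensorLift_ι, Category.id_comp]
    change cotensorι V W ≫ 𝟙 V.X ▷ W.X = _
    rw [id_whiskerRight, Category.comp_id])
  map_comp {V V' V''} f g := cotensor_hom_ext (by
    rw [cotensorLift_ι, Category.assoc, cotensorLift_ι, ← Category.assoc, cotensorLift_ι]
    change cotensorι V W ≫ (f.hom ≫ g.hom) ▷ W.X = _
    rw [comp_whiskerRight, Category.assoc])

/-- The property of a comonoid morphism `p : A ⟶ Q` of being the coequalizer in `M` of the two morphisms `A □_Q A ⇉ A` obtained from `A □_Q A ⟶ A ⊗ A` by applying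
the counit to the first, respectively the second, tensor factor. -/
def IsCotensorCoequalizer {A : M} [ComonObj A] (p : A ⟶ Q) [IsComonHom p] : Prop :=
  let e : cotensor (RightComod.ofHom p) (LeftComod.ofHom p) ⟶ A ⊗ A :=
    cotensorι (RightComod.ofHom p) (LeftComod.ofHom p)
  ∃ w : (e ≫ ε[A] ▷ A ≫ (λ_ A).hom) ≫ p = (e ≫ A ◁ ε[A] ≫ (ρ_ A).hom) ≫ p,
    Nonempty (IsColimit (Cofork.ofπ p w))

end Comodules

/-! ### Cocommutative comonoids in the category of left modules over a bimonoid -/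

section ModComon

variable {M : Type u} [Category.{v} M] [MonoidalCategory M] [BraidedCategory M]

/-- A cocommutative comonoid in the monoidal category of left modules over a bimonoid `A` (where
`A` acts diagonally on tensor products and through its counit on the unit object): a cocommutative
comonoid which is a left `A`-module, with `A`-linear comultiplication and counit. -/
structure ModComonCoc (A : M) [BimonObj A] where
  /-- The underlying object. -/
  X : M
  [comon : ComonObj X]
  [comm : IsCommComonObj X]
  [mod : ModObj A X]
  smul_comul : γ[A, X] ≫ Δ[X] = (Δ[A] ⊗ₘ Δ[X]) ≫ tensorμ A A X X ≫ (γ[A, X] ⊗ₘ γ[A, X])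
  smul_counit : γ[A, X] ≫ ε[X] = (ε[A] ⊗ₘ ε[X]) ≫ (λ_ (𝟙_ M)).hom

attribute [instance] ModComonCoc.comon ModComonCoc.comm ModComonCoc.mod

/-- A morphism of `A`-module comonoids from a bimonoid `A`, with its regular left action, to `Q`:
a comonoid morphism that is left `A`-linear. -/
structure IsModComonHom {A : M} [BimonObj A] (Q : ModComonCoc A) (p : A ⟶ Q.X) : Prop extends
    IsComonHom p where
  smul_hom : μ[A] ≫ p = A ◁ p ≫ γ[A, Q.X]

variable (M) in
/-- The faithful coflatness condition: for every cocommutative Hopf monoid `A` and every morphism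
`p : A ⟶ Q` of cocommutative comonoids in left `A`-modules that is an epimorphism in `M`, the
functor `(-) □_Q A` from right `Q`-comodules to `M` preserves and reflects epimorphisms. -/
def FaithfulCoflatnessCondition [HasEqualizers M] : Prop :=
  ∀ (A : HopfCoc M) (Q : ModComonCoc A.X) (p : A.X ⟶ Q.X) (hp : IsModComonHom Q p), Epi p →
    haveI : IsComonHom p := hp.toIsComonHom
    (cotensorFunctor (LeftComod.ofHom p)).PreservesEpimorphisms ∧
      (cotensorFunctor (LeftComod.ofHom p)).ReflectsEpimorphisms

/-- `p : A ⟶ Q` is the quotient `A/AK⁺` associated with `k : K ⟶ A`: the coequalizer in `M` of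
`A ⊗ K ⟶ A ⊗ A ⟶ A` (apply `k`, then multiply) and `A ⊗ K ⟶ A` (apply the counit of `K`). -/
def IsQuotientBy {K A : HopfCoc M} (k : K ⟶ A) {Q : M} (p : A.X ⟶ Q) : Prop :=
  ∃ w : (A.X ◁ k.hom ≫ μ[A.X]) ≫ p = (A.X ◁ ε[K.X] ≫ (ρ_ A.X).hom) ≫ p,
    Nonempty (IsColimit (Cofork.ofπ p w))

end ModComon

/-! Cocommutative comonoids in a symmetric monoidal category form a cartesian category with product
`⊗`, and cocommutative Hopf monoids are its group objects. Computations therefore follow those with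
elements of groups, expressed through `pairing`, `conv`, `tensorFst` and `tensorSnd`. Exactness of
`⊗` makes the image in `M` of a morphism `f` a Hopf monoid (`HopfCoc.exists_image`), so `f = p ≫ i`
with `p` epi and `i` mono in `M`. It also makes the equalizer `K` of x ↦ x₁ ⊗ p x₂ and x ↦ x ⊗ 1 a
Hopf monoid, which is the kernel of `p` (`IsHopfKernel.isKernel`).

The heart is `IsHopfKernel.isQuotientBy`: an epimorphism `p : A ⟶ I` of `M` is the quotient A →
A/AK⁺. As two points in one fibre of a group morphism differ by an element of its kernel, the
translation map A ⊗ K → A □_I A, a ⊗ x ↦ a₁x ⊗ a₂, is a split epimorphism. Put X = A/AK⁺.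
Cotensoring A → X with A gives an epimorphism, which forces X □_I A ≅ A. Hence X → I becomes mono
after cotensoring, so it is mono because the functor reflects epimorphisms, and then an isomorphism.

The rest is formal. The quotient by AK⁺ is the cokernel of `k` and the coequalizer of the cotensor
square. Hence epimorphisms of `M` are normal. A regular epimorphism has invertible mono part in its
image factorization; a monomorphism has an epi part with zero kernel, which is a cokernel of zero
and so a split monomorphism. -/

/-! ### Pairing of morphisms out of a comonoid -/

section Pairing

variable {M : Type u} [Category.{v} M] [MonoidalCategory M]

/-- The pairing `x ↦ f x₁ ⊗ g x₂` of two morphisms out of a comonoid. -/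
def pairing {X C D : M} [ComonObj X] (f : X ⟶ C) (g : X ⟶ D) : X ⟶ C ⊗ D :=
  Δ[X] ≫ (f ⊗ₘ g)

section

variable {X C D E F : M} [ComonObj X]

lemma comul_eq_pairing : Δ[X] = pairing (𝟙 X) (𝟙 X) := by simp [pairing]

lemma pairing_tensorHom (f : X ⟶ C) (g : X ⟶ D) (h : C ⟶ E) (k : D ⟶ F) :
    pairing f g ≫ (h ⊗ₘ k) = pairing (f ≫ h) (g ≫ k) := by
  simp [pairing]

lemma pairing_whiskerLeft (f : X ⟶ C) (g : X ⟶ D) (k : D ⟶ F) :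
    pairing f g ≫ C ◁ k = pairing f (g ≫ k) := by
  rw [← id_tensorHom, pairing_tensorHom, Category.comp_id]

lemma pairing_whiskerRight (f : X ⟶ C) (g : X ⟶ D) (k : C ⟶ F) :
    pairing f g ≫ k ▷ D = pairing (f ≫ k) g := by
  rw [← tensorHom_id, pairing_tensorHom, Category.comp_id]

lemma pairing_whiskerLeft_assoc (f : X ⟶ C) (g : X ⟶ D) (k : D ⟶ F) (h : C ⊗ F ⟶ E) :
    pairing f g ≫ C ◁ k ≫ h = pairing f (g ≫ k) ≫ h := by
  rw [← Category.assoc, pairing_whiskerLeft]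

lemma pairing_whiskerRight_assoc (f : X ⟶ C) (g : X ⟶ D) (k : C ⟶ F) (h : F ⊗ D ⟶ E) :
    pairing f g ≫ k ▷ D ≫ h = pairing (f ≫ k) g ≫ h := by
  rw [← Category.assoc, pairing_whiskerRight]

lemma pairing_tensorHom_assoc {G : M} (f : X ⟶ C) (g : X ⟶ D) (h : C ⟶ E) (k : D ⟶ F)
    (l : E ⊗ F ⟶ G) : pairing f g ≫ (h ⊗ₘ k) ≫ l = pairing (f ≫ h) (g ≫ k) ≫ l := by
  rw [← Category.assoc, pairing_tensorHom]

lemma pairing_associator_hom (f : X ⟶ C) (g : X ⟶ D) (h : X ⟶ E) :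
    pairing (pairing f g) h ≫ (α_ C D E).hom = pairing f (pairing g h) := by
  have h₁ : pairing (pairing f g) h = Δ ≫ Δ ▷ X ≫ ((f ⊗ₘ g) ⊗ₘ h) := by
    simp only [pairing, ← tensorHom_id, tensorHom_comp_tensorHom, Category.id_comp]
  have h₂ : pairing f (pairing g h) = Δ ≫ X ◁ Δ ≫ (f ⊗ₘ (g ⊗ₘ h)) := by
    simp only [pairing, ← id_tensorHom, tensorHom_comp_tensorHom, Category.id_comp]
  rw [h₁, h₂, ComonObj.comul_assoc_assoc, Category.assoc, Category.assoc,
    associator_naturality]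

lemma pairing_associator_hom_assoc {G : M} (f : X ⟶ C) (g : X ⟶ D) (h : X ⟶ E)
    (l : C ⊗ (D ⊗ E) ⟶ G) :
    pairing (pairing f g) h ≫ (α_ C D E).hom ≫ l = pairing f (pairing g h) ≫ l := by
  rw [← Category.assoc, pairing_associator_hom]

lemma pairing_associator_inv (f : X ⟶ C) (g : X ⟶ D) (h : X ⟶ E) :
    pairing f (pairing g h) ≫ (α_ C D E).inv = pairing (pairing f g) h := by
  rw [Iso.comp_inv_eq, pairing_associator_hom]

lemma pairing_counit_leftUnitor (g : X ⟶ D) : pairing ε[X] g ≫ (λ_ D).hom = g := by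
  simp [pairing]

lemma pairing_counit_rightUnitor (f : X ⟶ C) : pairing f ε[X] ≫ (ρ_ C).hom = f := by
  simp [pairing]

lemma comp_comul {Y : M} [ComonObj Y] (h : X ⟶ Y) [IsComonHom h] : h ≫ Δ[Y] = pairing h h := by
  rw [IsComonHom.hom_comul, pairing]

lemma comp_comul_assoc {Y G : M} [ComonObj Y] (h : X ⟶ Y) [IsComonHom h] (l : Y ⊗ Y ⟶ G) :
    h ≫ Δ[Y] ≫ l = pairing h h ≫ l := by
  rw [← Category.assoc, comp_comul]

/-- Naturality in the source uses compatibility of `h` with comultiplication, which is why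
`IsComonHom` instances are supplied for all morphisms used as elements. -/
lemma comp_pairing {Y : M} [ComonObj Y] (h : X ⟶ Y) [IsComonHom h] (f : Y ⟶ C) (g : Y ⟶ D) :
    h ≫ pairing f g = pairing (h ≫ f) (h ≫ g) := by
  rw [pairing, comp_comul_assoc, pairing_tensorHom]

end

/-- The convolution product of two morphisms from a comonoid to a monoid. -/
def conv {X A : M} [ComonObj X] [MonObj A] (f g : X ⟶ A) : X ⟶ A := pairing f g ≫ μ[A]

section

variable {X A : M} [ComonObj X] [MonObj A]

lemma conv_assoc (f g h : X ⟶ A) : conv (conv f g) h = conv f (conv g h) := by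
  simp only [conv, ← pairing_whiskerRight, ← pairing_whiskerLeft, Category.assoc, MonObj.mul_assoc,
    pairing_associator_hom_assoc]

lemma one_conv (f : X ⟶ A) : conv (ε[X] ≫ η[A]) f = f := by
  rw [conv, ← pairing_whiskerRight, Category.assoc, MonObj.one_mul, pairing_counit_leftUnitor]

lemma conv_one (f : X ⟶ A) : conv f (ε[X] ≫ η[A]) = f := by
  rw [conv, ← pairing_whiskerLeft, Category.assoc, MonObj.mul_one, pairing_counit_rightUnitor]

lemma conv_comp {B : M} [MonObj B] (f g : X ⟶ A) (h : A ⟶ B) [IsMonHom h] :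
    conv f g ≫ h = conv (f ≫ h) (g ≫ h) := by
  rw [conv, Category.assoc, IsMonHom.mul_hom, pairing_tensorHom_assoc, conv]

lemma comp_conv {Y : M} [ComonObj Y] (h : Y ⟶ X) [IsComonHom h] (f g : X ⟶ A) :
    h ≫ conv f g = conv (h ≫ f) (h ≫ g) := by
  rw [conv, ← Category.assoc, comp_pairing, conv]

end

/-- The projection of a tensor product of comonoids to the first factor. -/
def tensorFst (C D : M) [ComonObj D] : C ⊗ D ⟶ C := C ◁ ε[D] ≫ (ρ_ C).hom

/-- The projection of a tensor product of comonoids to the second factor. -/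
def tensorSnd (C D : M) [ComonObj C] : C ⊗ D ⟶ D := ε[C] ▷ D ≫ (λ_ D).hom

lemma pairing_tensorFst {X C D : M} [ComonObj X] [ComonObj D] (f : X ⟶ C) (g : X ⟶ D)
    [IsComonHom g] : pairing f g ≫ tensorFst C D = f := by
  rw [tensorFst, pairing_whiskerLeft_assoc, IsComonHom.hom_counit, pairing_counit_rightUnitor]

lemma pairing_tensorSnd {X C D : M} [ComonObj X] [ComonObj C] (f : X ⟶ C) (g : X ⟶ D)
    [IsComonHom f] : pairing f g ≫ tensorSnd C D = g := by
  rw [tensorSnd, pairing_whiskerRight_assoc, IsComonHom.hom_counit, pairing_counit_leftUnitor]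

section Braided

variable [BraidedCategory M]

lemma pairing_braiding {X C D : M} [ComonObj X] [IsCommComonObj X] (f : X ⟶ C) (g : X ⟶ D) :
    pairing f g ≫ (β_ C D).hom = pairing g f := by
  rw [pairing, Category.assoc, BraidedCategory.braiding_naturality,
    IsCommComonObj.comul_comm_assoc, pairing]

/-- Cocommutativity lets the two middle copies of the argument be exchanged, which absorbs the
braiding inside `tensorμ`. -/
lemma pairing_pairing_tensorμ {X C D E F : M} [ComonObj X] [IsCommComonObj X]
    (f : X ⟶ C) (g : X ⟶ D) (h : X ⟶ E) (k : X ⟶ F) :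
    pairing (pairing f g) (pairing h k) ≫ tensorμ C D E F = pairing (pairing f h) (pairing g k) := by
  simp only [tensorμ, pairing_associator_hom_assoc, pairing_whiskerLeft_assoc,
    pairing_associator_inv, pairing_whiskerRight, pairing_braiding, pairing_associator_hom]

instance isComonHom_pairing {X C D : M} [ComonObj X] [IsCommComonObj X] [ComonObj C] [ComonObj D]
    (f : X ⟶ C) (g : X ⟶ D) [IsComonHom f] [IsComonHom g] : IsComonHom (pairing f g) where
  hom_counit := by
    rw [Comon.tensorObj_counit, pairing_tensorHom_assoc, IsComonHom.hom_counit,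
      IsComonHom.hom_counit, pairing_counit_leftUnitor]
  hom_comul := by
    rw [Comon.tensorObj_comul, pairing_tensorHom_assoc, comp_comul, comp_comul, pairing_pairing_tensorμ]
    rfl

/-- The counits cancel the superfluous copies created by Δ ⊗ Δ; cocommutativity plays no role.
Morphisms out of `C ⊗ D` can thus be rewritten in terms of the two projections. -/
lemma pairing_fst_snd (C D : M) [ComonObj C] [ComonObj D] :
    pairing (tensorFst C D) (tensorSnd C D) = 𝟙 (C ⊗ D) := by
  have h : (tensorFst C D ⊗ₘ tensorSnd C D) =
      ((C ◁ ε[D]) ⊗ₘ (ε[C] ▷ D)) ≫ ((ρ_ C).hom ⊗ₘ (λ_ D).hom) := by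
    simp [tensorFst, tensorSnd]
  rw [pairing, h, Comon.tensorObj_comul, ← id_tensorHom, ← tensorHom_id, Category.assoc,
    ← tensorμ_natural_assoc, tensorHom_comp_tensorHom_assoc, id_tensorHom, tensorHom_id,
    ComonObj.comul_counit, ComonObj.counit_comul]
  simp only [tensorμ, braiding_tensorUnit_left]
  monoidal

instance isComonHom_tensorFst (C D : M) [ComonObj C] [ComonObj D] :
    IsComonHom (tensorFst C D) where
  hom_counit := by
    rw [tensorFst, Category.assoc, ← rightUnitor_naturality, ← unitors_equal,
      ← tensorHom_def'_assoc, Comon.tensorObj_counit]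
  hom_comul := by
    have h : (tensorFst C D ⊗ₘ tensorFst C D) =
        ((𝟙 C ⊗ₘ ε[D]) ⊗ₘ (𝟙 C ⊗ₘ ε[D])) ≫ ((ρ_ C).hom ⊗ₘ (ρ_ C).hom) := by
      simp [tensorFst]
    rw [Comon.tensorObj_comul, h, Category.assoc, ← tensorμ_natural_assoc,
      tensorHom_comp_tensorHom_assoc, ComonObj.counit_comul_hom, id_tensorHom_id,
      Category.comp_id, tensorHom_def', Category.assoc, tensorFst, Category.assoc,
      ← rightUnitor_naturality]
    simp only [tensorμ, braiding_tensorUnit_right, whiskerLeft_comp]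
    monoidal

instance isComonHom_tensorSnd (C D : M) [ComonObj C] [ComonObj D] :
    IsComonHom (tensorSnd C D) where
  hom_counit := by
    rw [tensorSnd, Category.assoc, ← leftUnitor_naturality,
      ← tensorHom_def_assoc, Comon.tensorObj_counit]
  hom_comul := by
    have h : (tensorSnd C D ⊗ₘ tensorSnd C D) =
        ((ε[C] ⊗ₘ 𝟙 D) ⊗ₘ (ε[C] ⊗ₘ 𝟙 D)) ≫ ((λ_ D).hom ⊗ₘ (λ_ D).hom) := by
      simp [tensorSnd]
    rw [Comon.tensorObj_comul, h, Category.assoc, ← tensorμ_natural_assoc,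
      tensorHom_comp_tensorHom_assoc, ComonObj.counit_comul_hom, id_tensorHom_id,
      Category.comp_id, MonoidalCategory.tensorHom_def, Category.assoc, tensorSnd, Category.assoc,
      ← leftUnitor_naturality]
    simp only [tensorμ, braiding_tensorUnit_left]
    monoidal

end Braided

end Pairing

/-! ### Comonoid morphisms into cocommutative bimonoids and Hopf monoids -/

section Convolution

variable {M : Type u} [Category.{v} M] [MonoidalCategory M] [BraidedCategory M]

instance isComonHom_mul (A : M) [BimonObj A] : IsComonHom μ[A] where
  hom_counit := BimonObj.mul_counit A
  hom_comul := by rw [Comon.tensorObj_comul, Category.assoc, BimonObj.mul_comul]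

instance isComonHom_counit_one (X A : M) [ComonObj X] [BimonObj A] :
    IsComonHom (ε[X] ≫ η[A]) where
  hom_counit := by rw [Category.assoc, BimonObj.one_counit, Category.comp_id]
  hom_comul := by
    rw [Category.assoc, Bimon.one_comul, ← tensorHom_comp_tensorHom,
      ComonObj.counit_comul_hom_assoc]

instance isComonHom_conv {X A : M} [ComonObj X] [IsCommComonObj X] [BimonObj A]
    (f g : X ⟶ A) [IsComonHom f] [IsComonHom g] : IsComonHom (conv f g) := by
  rw [conv]
  infer_instance

/-- The antipode reverses the comultiplication, and cocommutativity undoes the reversal. -/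
instance isComonHom_antipode (A : M) [HopfObj A] [IsCommComonObj A] :
    IsComonHom (HopfObj.antipode (X := A)) where
  hom_counit := HopfObj.antipode_counit A
  hom_comul := by rw [HopfObj.antipode_comul, IsCommComonObj.comul_comm_assoc]

variable {X A : M} [ComonObj X] [HopfObj A]

lemma antipode_conv (f : X ⟶ A) [IsComonHom f] :
    conv (f ≫ HopfObj.antipode) f = ε[X] ≫ η[A] := by
  rw [conv, ← pairing_whiskerRight, Category.assoc, ← comp_comul_assoc, HopfObj.antipode_left,
    IsComonHom.hom_counit_assoc]

lemma conv_antipode (f : X ⟶ A) [IsComonHom f] :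
    conv f (f ≫ HopfObj.antipode) = ε[X] ≫ η[A] := by
  rw [conv, ← pairing_whiskerLeft, Category.assoc, ← comp_comul_assoc, HopfObj.antipode_right,
    IsComonHom.hom_counit_assoc]

lemma conv_antipode_cancel (f g : X ⟶ A) [IsComonHom f] :
    conv f (conv (f ≫ HopfObj.antipode) g) = g := by
  rw [← conv_assoc, conv_antipode, one_conv]

end Convolution

/-! ### Tensor products of monomorphisms and of epimorphisms -/

section Exact

variable {M : Type u} [Category.{v} M] [MonoidalCategory M]

instance mono_whiskerLeft [∀ X : M, (tensorLeft X).PreservesMonomorphisms] (X : M) {C D : M}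
    (f : C ⟶ D) [Mono f] : Mono (X ◁ f) :=
  inferInstanceAs (Mono ((tensorLeft X).map f))

instance mono_whiskerRight [∀ X : M, (tensorRight X).PreservesMonomorphisms] (X : M) {C D : M}
    (f : C ⟶ D) [Mono f] : Mono (f ▷ X) :=
  inferInstanceAs (Mono ((tensorRight X).map f))

instance mono_tensorHom [∀ X : M, (tensorLeft X).PreservesMonomorphisms]
    [∀ X : M, (tensorRight X).PreservesMonomorphisms] {C D E F : M}
    (f : C ⟶ D) (g : E ⟶ F) [Mono f] [Mono g] : Mono (f ⊗ₘ g) := by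
  rw [MonoidalCategory.tensorHom_def]
  infer_instance

instance epi_whiskerLeft [∀ X : M, (tensorLeft X).PreservesEpimorphisms] (X : M) {C D : M}
    (f : C ⟶ D) [Epi f] : Epi (X ◁ f) :=
  inferInstanceAs (Epi ((tensorLeft X).map f))

instance epi_whiskerRight [∀ X : M, (tensorRight X).PreservesEpimorphisms] (X : M) {C D : M}
    (f : C ⟶ D) [Epi f] : Epi (f ▷ X) :=
  inferInstanceAs (Epi ((tensorRight X).map f))

instance epi_tensorHom [∀ X : M, (tensorLeft X).PreservesEpimorphisms]
    [∀ X : M, (tensorRight X).PreservesEpimorphisms] {C D E F : M}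
    (f : C ⟶ D) (g : E ⟶ F) [Epi f] [Epi g] : Epi (f ⊗ₘ g) := by
  rw [MonoidalCategory.tensorHom_def]
  infer_instance

end Exact

/-! ### Cocommutative Hopf submonoids -/

section Sub

variable {M : Type u} [Category.{v} M] [MonoidalCategory M]
  [∀ X : M, (tensorLeft X).PreservesMonomorphisms]
  [∀ X : M, (tensorRight X).PreservesMonomorphisms]

/-- The comonoid structure on a subobject to which the comultiplication restricts. -/
@[reducible]
def comonObjOfMono {X B : M} [ComonObj B] (i : X ⟶ B) [Mono i] (d : X ⟶ X ⊗ X)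
    (hd : d ≫ (i ⊗ₘ i) = i ≫ Δ[B]) : ComonObj X where
  counit := i ≫ ε[B]
  comul := d
  counit_comul := by
    -- Tensoring preserves monomorphisms, so each law can be tested inside `B`, where it holds.
    rw [← cancel_mono (𝟙_ M ◁ i), Category.assoc, ← MonoidalCategory.tensorHom_def,
      ← leftUnitor_inv_naturality, ← ComonObj.counit_comul, ← reassoc_of% hd,
      ← tensorHom_id, tensorHom_comp_tensorHom, Category.comp_id]
  comul_counit := by
    rw [← cancel_mono (i ▷ 𝟙_ M), Category.assoc, ← tensorHom_def',
      ← rightUnitor_inv_naturality, ← ComonObj.comul_counit, ← reassoc_of% hd,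
      ← id_tensorHom, tensorHom_comp_tensorHom, Category.comp_id]
  comul_assoc := by
    rw [← cancel_mono (i ⊗ₘ i ⊗ₘ i)]
    have h₁ : d ≫ X ◁ d ≫ (i ⊗ₘ i ⊗ₘ i) = i ≫ Δ[B] ≫ B ◁ Δ[B] := by
      rw [← id_tensorHom, ← id_tensorHom, tensorHom_comp_tensorHom, hd, Category.id_comp,
        ← reassoc_of% hd, tensorHom_comp_tensorHom, Category.comp_id]
    have h₂ : d ≫ d ▷ X ≫ ((i ⊗ₘ i) ⊗ₘ i) = i ≫ Δ[B] ≫ Δ[B] ▷ B := by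
      rw [← tensorHom_id, ← tensorHom_id, tensorHom_comp_tensorHom, hd, Category.id_comp,
        ← reassoc_of% hd, tensorHom_comp_tensorHom, Category.comp_id]
    rw [Category.assoc, h₁, Category.assoc, Category.assoc, ← associator_naturality,
      reassoc_of% h₂, ComonObj.comul_assoc]

variable [BraidedCategory M]

lemma isCommComonObj_of_mono {X B : M} [ComonObj X] [ComonObj B] [IsCommComonObj B] (i : X ⟶ B)
    [Mono i] [IsComonHom i] : IsCommComonObj X where
  comul_comm := by
    rw [← cancel_mono (i ⊗ₘ i), Category.assoc, ← BraidedCategory.braiding_naturality,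
      ← IsComonHom.hom_comul_assoc, IsCommComonObj.comul_comm, IsComonHom.hom_comul]

/-- The cocommutative Hopf monoid structure on a subobject to which the structure morphisms
restrict. -/
def HopfCoc.ofMono (B : HopfCoc M) {X : M} (i : X ⟶ B.X) [Mono i] (d : X ⟶ X ⊗ X)
    (hd : d ≫ (i ⊗ₘ i) = i ≫ Δ[B.X]) (e : 𝟙_ M ⟶ X) (he : e ≫ i = η[B.X])
    (m : X ⊗ X ⟶ X) (hm : m ≫ i = (i ⊗ₘ i) ≫ μ[B.X])
    (s : X ⟶ X) (hs : s ≫ i = i ≫ HopfObj.antipode) : HopfCoc M :=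
  letI c : ComonObj X := comonObjOfMono i d hd
  haveI : IsComonHom i := { hom_counit := rfl, hom_comul := hd.symm }
  letI a : MonObj X :=
    { one := e
      mul := m
      one_mul := by
        rw [← cancel_mono i, Category.assoc, hm, ← tensorHom_id, tensorHom_comp_tensorHom_assoc,
          he, Category.id_comp, tensorHom_def', Category.assoc, MonObj.one_mul,
          leftUnitor_naturality]
      mul_one := by
        rw [← cancel_mono i, Category.assoc, hm, ← id_tensorHom, tensorHom_comp_tensorHom_assoc,
          he, Category.id_comp, MonoidalCategory.tensorHom_def, Category.assoc, MonObj.mul_one,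
          rightUnitor_naturality]
      mul_assoc := by
        rw [← cancel_mono i]
        simp only [Category.assoc, hm]
        rw [← tensorHom_id, ← id_tensorHom, tensorHom_comp_tensorHom_assoc,
          tensorHom_comp_tensorHom_assoc, hm, Category.id_comp]
        have h₁ : ((i ⊗ₘ i) ≫ μ[B.X] ⊗ₘ i) = ((i ⊗ₘ i) ⊗ₘ i) ≫ μ[B.X] ▷ B.X := by
          rw [← tensorHom_id, tensorHom_comp_tensorHom, Category.comp_id]
        have h₂ : (i ⊗ₘ (i ⊗ₘ i) ≫ μ[B.X]) = (i ⊗ₘ i ⊗ₘ i) ≫ B.X ◁ μ[B.X] := by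
          rw [← id_tensorHom, tensorHom_comp_tensorHom, Category.comp_id]
        rw [h₁, h₂, Category.assoc, Category.assoc, MonObj.mul_assoc,
          associator_naturality_assoc] }
  haveI : IsMonHom i := { one_hom := he, mul_hom := hm }
  letI b : BimonObj X :=
    { a, c with
      mul_comul := by
        rw [← cancel_mono (i ⊗ₘ i)]
        simp only [Category.assoc]
        rw [← IsComonHom.hom_comul, IsMonHom.mul_hom_assoc, BimonObj.mul_comul,
          tensorHom_comp_tensorHom, IsMonHom.mul_hom, ← tensorHom_comp_tensorHom,
          ← tensorμ_natural_assoc, tensorHom_comp_tensorHom_assoc,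
          tensorHom_comp_tensorHom_assoc, IsComonHom.hom_comul]
      one_comul := by
        rw [← cancel_mono (i ⊗ₘ i), Category.assoc, ← IsComonHom.hom_comul,
          IsMonHom.one_hom_assoc, BimonObj.one_comul, MonObj.tensorObj.one_def,
          MonObj.tensorObj.one_def, Category.assoc, tensorHom_comp_tensorHom, IsMonHom.one_hom]
      mul_counit := by
        rw [← IsComonHom.hom_counit i, IsMonHom.mul_hom_assoc, BimonObj.mul_counit,
          Comon.tensorObj_counit, Comon.tensorObj_counit, tensorHom_comp_tensorHom_assoc,
          IsComonHom.hom_counit]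
      one_counit := by
        rw [← IsComonHom.hom_counit i, IsMonHom.one_hom_assoc, BimonObj.one_counit] }
  letI h : HopfObj X :=
    { b with
      antipode := s
      antipode_left := by
        rw [← cancel_mono i]
        simp only [Category.assoc]
        rw [IsMonHom.mul_hom, ← tensorHom_id, tensorHom_comp_tensorHom_assoc, hs,
          Category.id_comp]
        -- After unfolding `conv`, the law says that `i ≫ antipode` is a convolution inverse of `i`.
        exact (Category.assoc _ _ _).symm.trans
          ((antipode_conv i).trans (congrArg (ε[X] ≫ ·) he.symm))
      antipode_right := by
        rw [← cancel_mono i]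
        simp only [Category.assoc]
        rw [IsMonHom.mul_hom, ← id_tensorHom, tensorHom_comp_tensorHom_assoc, hs,
          Category.id_comp]
        exact (Category.assoc _ _ _).symm.trans
          ((conv_antipode i).trans (congrArg (ε[X] ≫ ·) he.symm)) }
  { X := X
    hopf := h
    comm := isCommComonObj_of_mono i }

/-- The inclusion of a cocommutative Hopf submonoid. -/
def HopfCoc.ofMonoι (B : HopfCoc M) {X : M} (i : X ⟶ B.X) [Mono i] (d : X ⟶ X ⊗ X)
    (hd : d ≫ (i ⊗ₘ i) = i ≫ Δ[B.X]) (e : 𝟙_ M ⟶ X) (he : e ≫ i = η[B.X])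
    (m : X ⊗ X ⟶ X) (hm : m ≫ i = (i ⊗ₘ i) ≫ μ[B.X])
    (s : X ⟶ X) (hs : s ≫ i = i ≫ HopfObj.antipode) :
    HopfCoc.ofMono B i d hd e he m hm s hs ⟶ B where
  hom := i
  isBimonHom :=
    { one_hom := he
      mul_hom := hm
      hom_counit := rfl
      hom_comul := hd.symm }

/-- A morphism into a cocommutative Hopf submonoid is a bimonoid morphism if its composite with
the inclusion is one. -/
lemma isBimonHom_of_comp_mono {A I B : HopfCoc M} (g : A.X ⟶ I.X) (i : I ⟶ B) [Mono i.hom]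
    [h : IsBimonHom (g ≫ i.hom)] : IsBimonHom g where
  one_hom := by
    rw [← cancel_mono i.hom, Category.assoc, IsMonHom.one_hom, IsMonHom.one_hom]
  mul_hom := by
    rw [← cancel_mono i.hom, Category.assoc, Category.assoc, IsMonHom.mul_hom, IsMonHom.mul_hom,
      tensorHom_comp_tensorHom_assoc]
  hom_counit := by
    rw [← IsComonHom.hom_counit i.hom, ← Category.assoc, IsComonHom.hom_counit]
  hom_comul := by
    rw [← cancel_mono (i.hom ⊗ₘ i.hom), Category.assoc, Category.assoc, ← IsComonHom.hom_comul,
      tensorHom_comp_tensorHom, ← Category.assoc, IsComonHom.hom_comul]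

end Sub

/-! ### Images and kernels of morphisms of cocommutative Hopf monoids -/

section Image

variable {M : Type u} [Category.{v} M] [Abelian M] [MonoidalCategory M] [BraidedCategory M]
  [∀ X : M, (tensorLeft X).PreservesMonomorphisms]
  [∀ X : M, (tensorRight X).PreservesMonomorphisms]
  [∀ X : M, (tensorLeft X).PreservesEpimorphisms]
  [∀ X : M, (tensorRight X).PreservesEpimorphisms]

/-- A morphism of cocommutative Hopf monoids factors as an epimorphism of `M` followed by a
monomorphism of `M`. -/
theorem HopfCoc.exists_image {A B : HopfCoc M} (f : A ⟶ B) :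
    ∃ (I : HopfCoc M) (p : A ⟶ I) (i : I ⟶ B), Epi p.hom ∧ Mono i.hom ∧ p ≫ i = f := by
  let p := factorThruImage f.hom
  let i := image.ι f.hom
  have hpi : p ≫ i = f.hom := image.fac f.hom
  -- The structure morphisms of the image are diagonal fillers: `p` and `p ⊗ₘ p` are strong
  -- epimorphisms, `i` and `i ⊗ₘ i` monomorphisms.
  have sq₁ : CommSq (Δ[A.X] ≫ (p ⊗ₘ p)) p (i ⊗ₘ i) (i ≫ Δ[B.X]) :=
    ⟨by rw [Category.assoc, tensorHom_comp_tensorHom, reassoc_of% hpi, hpi,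
      IsComonHom.hom_comul]⟩
  have sq₂ : CommSq (μ[A.X] ≫ p) (p ⊗ₘ p) i ((i ⊗ₘ i) ≫ μ[B.X]) :=
    ⟨by rw [Category.assoc, tensorHom_comp_tensorHom_assoc, hpi, IsMonHom.mul_hom]⟩
  have sq₃ : CommSq (HopfObj.antipode ≫ p) p i (i ≫ HopfObj.antipode) :=
    ⟨by rw [Category.assoc, reassoc_of% hpi, hpi, HopfObj.hom_antipode]⟩
  have : StrongEpi p := strongEpi_of_epi p
  have : StrongEpi (p ⊗ₘ p) := strongEpi_of_epi _
  have he : (η[A.X] ≫ p) ≫ i = η[B.X] := by rw [Category.assoc, hpi, IsMonHom.one_hom]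
  let I := HopfCoc.ofMono B i sq₁.lift sq₁.fac_right (η[A.X] ≫ p) he sq₂.lift sq₂.fac_right
    sq₃.lift sq₃.fac_right
  let j : I ⟶ B := HopfCoc.ofMonoι B i _ _ _ _ _ _ _ _
  let q : A.X ⟶ I.X := p
  have hq : Epi q := inferInstanceAs (Epi p)
  have hj : Mono j.hom := inferInstanceAs (Mono i)
  have hqj : q ≫ j.hom = f.hom := hpi
  have : IsBimonHom (q ≫ j.hom) := by
    rw [hqj]
    infer_instance
  exact ⟨I, { hom := q, isBimonHom := isBimonHom_of_comp_mono q j }, j, hq, hj,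
    HopfCoc.hom_ext hqj⟩

end Image

/-! ### Hopf kernels. -/

section Kernel

variable {M : Type u} [Category.{v} M] [MonoidalCategory M]

/-- The property of `k : K ⟶ A` of being the equalizer in `M` of `x ↦ x₁ ⊗ f x₂` and
`x ↦ x ⊗ 1`. -/
def IsHopfKernel [BraidedCategory M] {K A B : HopfCoc M} (k : K ⟶ A) (f : A ⟶ B) : Prop :=
  ∃ w : k.hom ≫ pairing (𝟙 A.X) f.hom = k.hom ≫ pairing (𝟙 A.X) (ε[A.X] ≫ η[B.X]),
    Nonempty (IsLimit (Fork.ofι k.hom w))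

/-- For comonoid morphisms, triviality of `h ≫ f` suffices to factor through the Hopf kernel. -/
lemma comp_pairing_id_eq [BraidedCategory M] {Z : M} [ComonObj Z] {A B : HopfCoc M} (f : A ⟶ B)
    (h : Z ⟶ A.X) [IsComonHom h] (w : h ≫ f.hom = ε[Z] ≫ η[B.X]) :
    h ≫ pairing (𝟙 A.X) f.hom = h ≫ pairing (𝟙 A.X) (ε[A.X] ≫ η[B.X]) := by
  rw [comp_pairing, comp_pairing, w, IsComonHom.hom_counit_assoc]

/-- Applying the counit to the first factor gives this converse, with no comonoid structure on `Z`.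
-/
lemma comp_eq_of_comp_pairing_id_eq [BraidedCategory M] {Z : M} {A B : HopfCoc M} (f : A ⟶ B)
    (h : Z ⟶ A.X)
    (w : h ≫ pairing (𝟙 A.X) f.hom = h ≫ pairing (𝟙 A.X) (ε[A.X] ≫ η[B.X])) :
    h ≫ f.hom = h ≫ ε[A.X] ≫ η[B.X] := by
  simpa only [Category.assoc, pairing_tensorSnd] using w =≫ tensorSnd A.X B.X

variable [SymmetricCategory M]

lemma tensorHom_mul_eq_conv {C D A : M} [ComonObj C] [ComonObj D] [MonObj A]
    (f : C ⟶ A) (g : D ⟶ A) :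
    (f ⊗ₘ g) ≫ μ[A] = conv (tensorFst C D ≫ f) (tensorSnd C D ≫ g) := by
  rw [conv, ← pairing_tensorHom, pairing_fst_snd, Category.id_comp]

section

variable [∀ X : M, PreservesFiniteLimits (tensorLeft X)]

/-- The equalizer of `x ↦ x₁ ⊗ f x₂` and `x ↦ x ⊗ 1` is closed under comultiplication. -/
lemma exists_comul_lift {A B : HopfCoc M} (f : A ⟶ B) {X : M} (i : X ⟶ A.X)
    (w : i ≫ pairing (𝟙 A.X) f.hom = i ≫ pairing (𝟙 A.X) (ε[A.X] ≫ η[B.X]))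
    (hi : IsLimit (Fork.ofι i w)) : ∃ d : X ⟶ X ⊗ X, d ≫ (i ⊗ₘ i) = i ≫ Δ[A.X] := by
  have : Mono i := mono_of_isLimit_fork hi
  have hcomul (g : A.X ⟶ B.X) : Δ[A.X] ≫ A.X ◁ pairing (𝟙 A.X) g =
      pairing (𝟙 A.X) g ≫ Δ[A.X] ▷ B.X ≫ (α_ _ _ _).hom := by
    conv_lhs => rw [comul_eq_pairing]
    rw [pairing_whiskerLeft, pairing_whiskerRight_assoc, Category.id_comp, Category.id_comp,
      comul_eq_pairing, pairing_associator_hom]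
  -- By coassociativity `i ≫ Δ` equalizes the pair tensored with `A` on the left, so it lands in A ⊗
  -- X.
  obtain ⟨t, ht⟩ := Fork.IsLimit.lift' (isLimitForkMapOfIsLimit (tensorLeft A.X) w hi)
    (i ≫ Δ[A.X]) (by
      change (i ≫ Δ[A.X]) ≫ A.X ◁ _ = (i ≫ Δ[A.X]) ≫ A.X ◁ _
      rw [Category.assoc, Category.assoc, hcomul, hcomul, reassoc_of% w])
  change t ≫ A.X ◁ i = i ≫ Δ[A.X] at ht
  -- Cocommutativity transfers the argument to the left factor, which moves the image from A ⊗ X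
  -- into X ⊗ X.
  have hcomul' (g : A.X ⟶ B.X) : Δ[A.X] ≫ pairing (𝟙 A.X) g ▷ A.X =
      Δ[A.X] ≫ A.X ◁ pairing (𝟙 A.X) g ≫ (β_ _ _).hom := by
    rw [comul_eq_pairing, pairing_whiskerLeft_assoc, pairing_whiskerRight, pairing_braiding]
  obtain ⟨d, hd⟩ := Fork.IsLimit.lift' (isLimitForkMapOfIsLimit (tensorRight X) w hi) t (by
    change t ≫ _ ▷ X = t ≫ _ ▷ X
    rw [← cancel_mono ((A.X ⊗ B.X) ◁ i), Category.assoc, Category.assoc, ← whisker_exchange,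
      ← whisker_exchange, reassoc_of% ht, reassoc_of% ht, hcomul', hcomul',
      reassoc_of% hcomul f.hom, reassoc_of% hcomul (ε[A.X] ≫ η[B.X]), reassoc_of% w])
  change d ≫ i ▷ X = t at hd
  exact ⟨d, by rw [MonoidalCategory.tensorHom_def, reassoc_of% hd, ht]⟩

/-- Every morphism of cocommutative Hopf monoids has a Hopf kernel. -/
theorem HopfCoc.exists_isHopfKernel [HasEqualizers M]
    [∀ X : M, (tensorRight X).PreservesMonomorphisms] {A B : HopfCoc M} (f : A ⟶ B) :
    ∃ (K : HopfCoc M) (k : K ⟶ A), IsHopfKernel k f := by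
  let i := equalizer.ι (pairing (𝟙 A.X) f.hom) (pairing (𝟙 A.X) (ε[A.X] ≫ η[B.X]))
  have w : i ≫ pairing (𝟙 A.X) f.hom = i ≫ pairing (𝟙 A.X) (ε[A.X] ≫ η[B.X]) :=
    equalizer.condition _ _
  have hi : IsLimit (Fork.ofι i w) := equalizerIsEqualizer _ _
  obtain ⟨d, hd⟩ := exists_comul_lift f i w hi
  -- The comonoid structure must come first: it makes the restricted multiplication and antipode
  -- comonoid morphisms, to which `comp_pairing_id_eq` applies.
  let := comonObjOfMono i d hd
  have : IsComonHom i := { hom_counit := rfl, hom_comul := hd.symm }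
  have := isCommComonObj_of_mono i
  have hf : i ≫ f.hom = ε ≫ η[B.X] := by
    rw [comp_eq_of_comp_pairing_id_eq f i w, IsComonHom.hom_counit_assoc]
  obtain ⟨e, he⟩ := Fork.IsLimit.lift' hi η[A.X] (by
    simp only [pairing, Bimon.one_comul_assoc, tensorHom_comp_tensorHom, IsMonHom.one_hom,
      BimonObj.one_counit_assoc])
  obtain ⟨m, hm⟩ := Fork.IsLimit.lift' hi ((i ⊗ₘ i) ≫ μ[A.X]) (by
    rw [tensorHom_mul_eq_conv]
    refine comp_pairing_id_eq f _ ?_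
    rw [conv_comp, Category.assoc, Category.assoc, hf, IsComonHom.hom_counit_assoc,
      IsComonHom.hom_counit_assoc, one_conv])
  obtain ⟨s, hs⟩ := Fork.IsLimit.lift' hi (i ≫ HopfObj.antipode) (by
    refine comp_pairing_id_eq f _ ?_
    rw [Category.assoc, ← HopfObj.hom_antipode, reassoc_of% hf, HopfObj.one_antipode])
  exact ⟨_, HopfCoc.ofMonoι A i d hd e he m hm s hs, w, ⟨hi⟩⟩

end

namespace IsHopfKernel

variable {K A B : HopfCoc M} {k : K ⟶ A} {f : A ⟶ B}

lemma mono_hom (h : IsHopfKernel k f) : Mono k.hom :=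
  mono_of_isLimit_fork h.choose_spec.some

lemma comp_hom_eq (h : IsHopfKernel k f) : k.hom ≫ f.hom = ε[K.X] ≫ η[B.X] := by
  rw [comp_eq_of_comp_pairing_id_eq f k.hom h.choose, IsComonHom.hom_counit_assoc]

lemma comp_eq_zero (h : IsHopfKernel k f) : k ≫ f = 0 :=
  HopfCoc.hom_ext h.comp_hom_eq

/-- A Hopf kernel is a kernel in the category of cocommutative Hopf monoids. -/
lemma isKernel [∀ X : M, (tensorLeft X).PreservesMonomorphisms]
    [∀ X : M, (tensorRight X).PreservesMonomorphisms] (h : IsHopfKernel k f) :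
    Nonempty (IsLimit (KernelFork.ofι k h.comp_eq_zero)) := by
  have := h.mono_hom
  have hl (C : HopfCoc M) (g : C ⟶ A) (hg : g ≫ f = 0) : ∃ l : C ⟶ K, l ≫ k = g := by
    obtain ⟨l, hl⟩ := Fork.IsLimit.lift' h.choose_spec.some g.hom
      (comp_pairing_id_eq f g.hom (congrArg HopfCoc.Hom.hom hg))
    change l ≫ k.hom = g.hom at hl
    have : IsBimonHom (l ≫ k.hom) := by rw [hl]; infer_instance
    exact ⟨{ hom := l, isBimonHom := isBimonHom_of_comp_mono l k }, HopfCoc.hom_ext hl⟩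
  choose l hl using hl
  refine ⟨KernelFork.IsLimit.ofι _ _ (fun g hg => l _ g hg) (fun g hg => hl _ g hg)
    fun g hg m hm => HopfCoc.hom_ext ?_⟩
  rw [← cancel_mono k.hom, ← HopfCoc.comp_hom, hm, ← HopfCoc.comp_hom, hl]

end IsHopfKernel

end Kernel

/-! ### Subcomodules and quotient comodules -/

section Comodules

variable {M : Type u} [Category.{v} M] [MonoidalCategory M] {Q : M} [ComonObj Q]

/-- The comodule structure on a quotient object to which the coaction descends. -/
def RightComod.ofEpi (V : RightComod Q) {X : M} (q : V.X ⟶ X) [Epi q] (c : X ⟶ X ⊗ Q)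
    (hc : q ≫ c = V.coact ≫ q ▷ Q) : RightComod Q where
  X := X
  coact := c
  coact_counit := by
    rw [← cancel_epi q, reassoc_of% hc, ← whisker_exchange, ← Category.assoc, V.coact_counit,
      rightUnitor_inv_naturality]
  coact_comul := by
    rw [← cancel_epi q, reassoc_of% hc, reassoc_of% hc, ← whisker_exchange, ← Category.assoc,
      V.coact_comul, ← comp_whiskerRight_assoc, hc]
    simp

/-- The comodule structure on a subobject to which the coaction restricts. -/
def RightComod.ofMono [∀ X : M, (tensorRight X).PreservesMonomorphisms]
    (V : RightComod Q) {X : M} (n : X ⟶ V.X) [Mono n] (c : X ⟶ X ⊗ Q)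
    (hc : c ≫ n ▷ Q = n ≫ V.coact) : RightComod Q where
  X := X
  coact := c
  coact_counit := by
    rw [← cancel_mono (n ▷ 𝟙_ M), Category.assoc, whisker_exchange, reassoc_of% hc,
      V.coact_counit, rightUnitor_inv_naturality]
  coact_comul := by
    rw [← cancel_mono (n ▷ (Q ⊗ Q)), Category.assoc, whisker_exchange, reassoc_of% hc,
      V.coact_comul, ← reassoc_of% hc, ← comp_whiskerRight_assoc, ← hc]
    simp

/-- Bridges epimorphisms of `M` and the coflatness condition, which concerns epimorphisms of the
category of comodules. -/
lemma RightComod.epi_of_epi_hom {V W : RightComod Q} (f : V ⟶ W) [Epi f.hom] : Epi f where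
  left_cancellation g h w := RightComod.Hom.ext <| by
    rw [← cancel_epi f.hom]
    exact congrArg RightComod.Hom.hom w

section

variable [HasEqualizers M] (W : LeftComod Q)

/-- The inclusion of the cotensor product in the tensor product. -/
noncomputable def cotensorFunctorι (V : RightComod Q) :
    (cotensorFunctor W).obj V ⟶ V.X ⊗ W.X :=
  cotensorι V W

instance (V : RightComod Q) : Mono (cotensorFunctorι W V) :=
  ⟨fun _ _ h => cotensor_hom_ext h⟩

lemma cotensorFunctor_map_ι {V V' : RightComod Q} (g : V ⟶ V') :
    (cotensorFunctor W).map g ≫ cotensorFunctorι W V' = cotensorFunctorι W V ≫ g.hom ▷ W.X :=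
  cotensorLift_ι _ _ _ _

lemma cotensorFunctor_map_ι_assoc {V V' : RightComod Q} (g : V ⟶ V') {Z : M}
    (l : V'.X ⊗ W.X ⟶ Z) : (cotensorFunctor W).map g ≫ cotensorFunctorι W V' ≫ l =
      cotensorFunctorι W V ≫ g.hom ▷ W.X ≫ l := by
  rw [← Category.assoc, cotensorFunctor_map_ι, Category.assoc]

end

end Comodules

/-! ### The action of a Hopf monoid on the target of a morphism -/

section Action

variable {M : Type u} [Category.{v} M] [MonoidalCategory M] [BraidedCategory M]

/-- The target of a morphism of cocommutative Hopf monoids as a comonoid in left modules over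
the source. -/
def ModComonCoc.ofHom {A I : HopfCoc M} (p : A ⟶ I) : ModComonCoc A.X where
  X := I.X
  mod :=
    { smul := p.hom ▷ I.X ≫ μ[I.X]
      one_smul := by
        change η[A.X] ▷ I.X ≫ p.hom ▷ I.X ≫ μ[I.X] = (λ_ I.X).hom
        rw [← comp_whiskerRight_assoc, IsMonHom.one_hom, MonObj.one_mul]
      mul_smul := by
        change μ[A.X] ▷ I.X ≫ p.hom ▷ I.X ≫ μ[I.X] =
          (α_ A.X A.X I.X).hom ≫ A.X ◁ (p.hom ▷ I.X ≫ μ[I.X]) ≫ p.hom ▷ I.X ≫ μ[I.X]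
        rw [← comp_whiskerRight_assoc, IsMonHom.mul_hom, comp_whiskerRight_assoc,
          MonObj.mul_assoc, ← tensorHom_id, associator_naturality_assoc, tensorHom_id,
          ← id_tensorHom, tensorHom_comp_tensorHom_assoc, Category.comp_id,
          tensorHom_def'_assoc] }
  smul_comul := by
    change (p.hom ▷ I.X ≫ μ[I.X]) ≫ Δ[I.X] = (Δ[A.X] ⊗ₘ Δ[I.X]) ≫ tensorμ _ _ _ _ ≫
      (p.hom ▷ I.X ≫ μ[I.X] ⊗ₘ p.hom ▷ I.X ≫ μ[I.X])
    rw [Category.assoc, BimonObj.mul_comul, ← tensorHom_id, tensorHom_comp_tensorHom_assoc,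
      IsComonHom.hom_comul, Category.id_comp, ← tensorHom_comp_tensorHom, ← tensorμ_natural_assoc,
      tensorHom_comp_tensorHom_assoc, id_tensorHom_id, Category.comp_id]
  smul_counit := by
    change (p.hom ▷ I.X ≫ μ[I.X]) ≫ ε[I.X] = _
    rw [Category.assoc, Bimon.mul_counit, ← tensorHom_id, tensorHom_comp_tensorHom_assoc,
      IsComonHom.hom_counit, Category.id_comp]

lemma ModComonCoc.isModComonHom_ofHom {A I : HopfCoc M} (p : A ⟶ I) :
    IsModComonHom (ModComonCoc.ofHom p) p.hom where
  hom_counit := IsComonHom.hom_counit p.hom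
  hom_comul := IsComonHom.hom_comul p.hom
  smul_hom := by
    change μ[A.X] ≫ p.hom = A.X ◁ p.hom ≫ p.hom ▷ I.X ≫ μ[I.X]
    rw [IsMonHom.mul_hom, tensorHom_def'_assoc]

/-- A morphism whose composite with an epimorphism is a bimonoid morphism is one. -/
lemma isBimonHom_of_epi_comp [∀ X : M, (tensorLeft X).PreservesEpimorphisms]
    [∀ X : M, (tensorRight X).PreservesEpimorphisms] {A I B : HopfCoc M} (p : A ⟶ I)
    [Epi p.hom] (g : I.X ⟶ B.X) [h : IsBimonHom (p.hom ≫ g)] : IsBimonHom g where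
  one_hom := by
    rw [← IsMonHom.one_hom p.hom, Category.assoc, IsMonHom.one_hom]
  mul_hom := by
    rw [← cancel_epi (p.hom ⊗ₘ p.hom), ← IsMonHom.mul_hom_assoc, IsMonHom.mul_hom (p.hom ≫ g),
      tensorHom_comp_tensorHom_assoc]
  hom_counit := by
    rw [← cancel_epi p.hom, IsComonHom.hom_counit p.hom, ← Category.assoc,
      IsComonHom.hom_counit]
  hom_comul := by
    rw [← cancel_epi p.hom, ← Category.assoc, IsComonHom.hom_comul (p.hom ≫ g),
      IsComonHom.hom_comul_assoc, tensorHom_comp_tensorHom]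

end Action

/-! ### The translation map -/

section Translation

variable {M : Type u} [Category.{v} M] [MonoidalCategory M] [SymmetricCategory M]

lemma whiskerLeft_mul_eq_conv {K A : HopfCoc M} (k : K ⟶ A) :
    A.X ◁ k.hom ≫ μ[A.X] =
      conv (tensorFst A.X K.X) (tensorSnd A.X K.X ≫ k.hom) := by
  rw [← id_tensorHom, tensorHom_mul_eq_conv, Category.comp_id]

lemma whiskerLeft_eq_pairing {K A : HopfCoc M} (k : K ⟶ A) :
    A.X ◁ k.hom = pairing (tensorFst A.X K.X) (tensorSnd A.X K.X ≫ k.hom) := by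
  rw [← pairing_whiskerLeft, pairing_fst_snd, Category.id_comp]

/-- Two comonoid morphisms identified by `p` define a morphism to the cotensor square. -/
lemma pairing_coact_eq {Z : M} [ComonObj Z] {A I : HopfCoc M} (p : A ⟶ I) (f g : Z ⟶ A.X)
    [IsComonHom f] [IsComonHom g] (h : f ≫ p.hom = g ≫ p.hom) :
    pairing f g ≫ (RightComod.ofHom p.hom).coact ▷ A.X ≫ (α_ A.X I.X A.X).hom =
      pairing f g ≫ A.X ◁ (LeftComod.ofHom p.hom).coact := by
  change pairing f g ≫ (Δ[A.X] ≫ A.X ◁ p.hom) ▷ A.X ≫ (α_ A.X I.X A.X).hom =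
    pairing f g ≫ A.X ◁ (Δ[A.X] ≫ p.hom ▷ A.X)
  rw [pairing_whiskerRight_assoc, pairing_whiskerLeft, comp_comul_assoc, comp_comul_assoc,
    pairing_whiskerLeft, pairing_whiskerRight, pairing_associator_hom, h]

/-- p(a k(x)) = p(a) p(k(x)) = p(a) ε(x). -/
lemma conv_tensorSnd_comp {K A I : HopfCoc M} {k : K ⟶ A} {p : A ⟶ I}
    (w : k.hom ≫ p.hom = ε[K.X] ≫ η[I.X]) :
    conv (tensorFst A.X K.X) (tensorSnd A.X K.X ≫ k.hom) ≫ p.hom =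
      tensorFst A.X K.X ≫ p.hom := by
  rw [conv_comp, Category.assoc, w, IsComonHom.hom_counit_assoc, conv_one]

variable [HasEqualizers M]

/-- The canonical morphism `A □_Q A ⟶ A ⊗ A`. -/
noncomputable def cotensorSquareι {A Q : M} [ComonObj A] [ComonObj Q] (p : A ⟶ Q) [IsComonHom p] :
    cotensor (RightComod.ofHom p) (LeftComod.ofHom p) ⟶ A ⊗ A :=
  cotensorι (RightComod.ofHom p) (LeftComod.ofHom p)

section

variable {A I : HopfCoc M} (p : A ⟶ I)

/-- This is x₁ ⊗ p x₂ ⊗ y = x ⊗ p y₁ ⊗ y₂. The cotensor square is given no comonoid structure, so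
its inclusion cannot be moved inside a `pairing`; further identities come from postcomposing this
one. -/
lemma cotensorSquareι_comp_pairing :
    cotensorSquareι p.hom ≫
        pairing (tensorFst A.X A.X) (pairing (tensorFst A.X A.X ≫ p.hom) (tensorSnd A.X A.X)) =
      cotensorSquareι p.hom ≫
        pairing (tensorFst A.X A.X)
          (pairing (tensorSnd A.X A.X ≫ p.hom) (tensorSnd A.X A.X)) := by
  have h := cotensor_condition (RightComod.ofHom p.hom) (LeftComod.ofHom p.hom)
  have h₁ : (RightComod.ofHom p.hom).coact ▷ A.X ≫ (α_ A.X I.X A.X).hom =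
      pairing (tensorFst A.X A.X)
        (pairing (tensorFst A.X A.X ≫ p.hom) (tensorSnd A.X A.X)) := by
    change (Δ[A.X] ≫ A.X ◁ p.hom) ▷ A.X ≫ (α_ A.X I.X A.X).hom = _
    rw [← Category.id_comp (_ ≫ _), ← pairing_fst_snd, pairing_whiskerRight_assoc,
      comp_comul_assoc, pairing_whiskerLeft, pairing_associator_hom]
  have h₂ : A.X ◁ (LeftComod.ofHom p.hom).coact =
      pairing (tensorFst A.X A.X)
        (pairing (tensorSnd A.X A.X ≫ p.hom) (tensorSnd A.X A.X)) := by
    change A.X ◁ (Δ[A.X] ≫ p.hom ▷ A.X) = _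
    rw [← Category.id_comp (_ ◁ _), ← pairing_fst_snd, pairing_whiskerLeft,
      comp_comul_assoc, pairing_whiskerRight]
  rw [← h₁, ← h₂]
  exact h

lemma cotensorSquareι_tensorFst_comp :
    cotensorSquareι p.hom ≫ tensorFst A.X A.X ≫ p.hom =
      cotensorSquareι p.hom ≫
        tensorSnd A.X A.X ≫ p.hom := by
  have h := cotensorSquareι_comp_pairing p =≫ (tensorSnd A.X (I.X ⊗ A.X) ≫ tensorFst I.X A.X)
  rwa [Category.assoc, Category.assoc, ← Category.assoc (pairing _ _),
    ← Category.assoc (pairing _ _), pairing_tensorSnd, pairing_tensorSnd, pairing_tensorFst,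
    pairing_tensorFst] at h

end

variable {K A I : HopfCoc M} {k : K ⟶ A} {p : A ⟶ I} (w : k.hom ≫ p.hom = ε[K.X] ≫ η[I.X])

/-- The translation morphism `a ⊗ x ↦ a₁ x ⊗ a₂` from `A ⊗ K` to the cotensor square. -/
noncomputable def translation (w : k.hom ≫ p.hom = ε[K.X] ≫ η[I.X]) :
    A.X ⊗ K.X ⟶ cotensor (RightComod.ofHom p.hom) (LeftComod.ofHom p.hom) :=
  cotensorLift (RightComod.ofHom p.hom) (LeftComod.ofHom p.hom)
    (show A.X ⊗ K.X ⟶ A.X ⊗ A.X from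
      pairing (conv (tensorFst A.X K.X) (tensorSnd A.X K.X ≫ k.hom)) (tensorFst A.X K.X))
    (pairing_coact_eq p _ _ (conv_tensorSnd_comp w))

lemma translation_ι : translation w ≫ cotensorSquareι p.hom =
    pairing (conv (tensorFst A.X K.X) (tensorSnd A.X K.X ≫ k.hom)) (tensorFst A.X K.X) :=
  cotensorLift_ι _ _ _ _

/-- The translation morphism of a Hopf kernel has the section
`x ⊗ y ↦ y₁ ⊗ S(y₂) x`. -/
lemma IsHopfKernel.isSplitEpi_translation [∀ X : M, PreservesFiniteLimits (tensorLeft X)]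
    (h : IsHopfKernel k p) : IsSplitEpi (translation h.comp_hom_eq) := by
  let e := cotensorSquareι p.hom
  let x := tensorFst A.X A.X
  let y := tensorSnd A.X A.X
  let c := conv (y ≫ HopfObj.antipode) x
  let u := tensorFst A.X (I.X ⊗ A.X)
  let s := tensorSnd A.X (I.X ⊗ A.X) ≫ tensorFst I.X A.X
  let t := tensorSnd A.X (I.X ⊗ A.X) ≫ tensorSnd I.X A.X
  -- `G` sends x ⊗ z ⊗ y to y₁ ⊗ S(y₂)x ⊗ S(p y₃)z. Taking z = p x gives p of S(y)x in the last
  -- factor, while z = p y gives a trivial factor; on the cotensor square the two agree.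
  let G : A.X ⊗ (I.X ⊗ A.X) ⟶ A.X ⊗ (A.X ⊗ I.X) :=
    pairing t (pairing (conv (t ≫ HopfObj.antipode) u)
      (conv (t ≫ HopfObj.antipode ≫ p.hom) s))
  have hG (z : A.X ⊗ A.X ⟶ I.X) [IsComonHom z] : pairing x (pairing z y) ≫ G =
      pairing y (pairing c (conv (y ≫ p.hom ≫ HopfObj.antipode) z)) := by
    have hu : pairing x (pairing z y) ≫ u = x := pairing_tensorFst _ _
    have hs : pairing x (pairing z y) ≫ s = z := by
      rw [← Category.assoc, pairing_tensorSnd, pairing_tensorFst]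
    have ht : pairing x (pairing z y) ≫ t = y := by
      rw [← Category.assoc, pairing_tensorSnd, pairing_tensorSnd]
    simp only [G, comp_pairing, comp_conv, reassoc_of% ht, hu, hs, ht, HopfObj.hom_antipode, c]
  have hc : e ≫ pairing y c ≫ A.X ◁ pairing (𝟙 A.X) p.hom =
      e ≫ pairing y c ≫ A.X ◁ pairing (𝟙 A.X) (ε[A.X] ≫ η[I.X]) := by
    have h₁ := cotensorSquareι_comp_pairing p =≫ G
    rw [Category.assoc, Category.assoc, hG, hG, ← Category.assoc y, antipode_conv] at h₁
    rw [pairing_whiskerLeft, pairing_whiskerLeft, comp_pairing c, comp_pairing c,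
      IsComonHom.hom_counit_assoc, Category.comp_id, conv_comp, Category.assoc,
      ← HopfObj.hom_antipode, ← Category.assoc y, h₁]
  obtain ⟨l, hl⟩ := Fork.IsLimit.lift'
    (isLimitForkMapOfIsLimit (tensorLeft A.X) _ h.choose_spec.some) (e ≫ pairing y c) (by
      change (e ≫ pairing y c) ≫ A.X ◁ _ = (e ≫ pairing y c) ≫ A.X ◁ _
      simpa only [Category.assoc] using hc)
  change l ≫ A.X ◁ k.hom = e ≫ pairing y c at hl
  refine ⟨⟨⟨l, cotensor_hom_ext (?_ : _ ≫ cotensorSquareι p.hom = _ ≫ cotensorSquareι p.hom)⟩⟩⟩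
  have hφ : pairing (conv (tensorFst A.X K.X) (tensorSnd A.X K.X ≫ k.hom)) (tensorFst A.X K.X) =
      A.X ◁ k.hom ≫ pairing (conv x y) x := by
    rw [whiskerLeft_eq_pairing, comp_pairing, comp_conv, pairing_tensorFst, pairing_tensorSnd]
  -- The composite is x ⊗ y ↦ y₁S(y₂)x ⊗ y₃ = x ⊗ y.
  rw [Category.assoc, translation_ι, hφ, reassoc_of% hl, comp_pairing, comp_conv,
    pairing_tensorFst, pairing_tensorSnd, conv_antipode_cancel, pairing_fst_snd,
    Category.comp_id, Category.id_comp]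

end Translation

/-! ### Quotients by Hopf kernels under faithful coflatness -/

section Quotient

variable {M : Type u} [Category.{v} M] [MonoidalCategory M] [SymmetricCategory M]
  {K A I : HopfCoc M} {k : K ⟶ A} {p : A ⟶ I}

/-- The quotient associated with the Hopf kernel of `p` coequalizes the cotensor square. -/
lemma IsQuotientBy.isCotensorCoequalizer [HasEqualizers M]
    (w : k.hom ≫ p.hom = ε[K.X] ≫ η[I.X]) (h : IsQuotientBy k p.hom) :
    IsCotensorCoequalizer p.hom := by
  obtain ⟨w', ⟨hp⟩⟩ := h
  have hπ : Epi p.hom := epi_of_isColimit_cofork hp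
  have hcond : (cotensorSquareι p.hom ≫ tensorSnd A.X A.X) ≫ p.hom =
      (cotensorSquareι p.hom ≫ tensorFst A.X A.X) ≫ p.hom := by
    rw [Category.assoc, Category.assoc, cotensorSquareι_tensorFst_comp]
  -- Precomposing the two projections of the cotensor square with `translation` gives a ⊗ x ↦ ax and
  -- a ⊗ x ↦ aε(x).
  have hdesc {Z : M} (g : A.X ⟶ Z) (hg : (cotensorSquareι p.hom ≫ tensorSnd A.X A.X) ≫ g =
      (cotensorSquareι p.hom ≫ tensorFst A.X A.X) ≫ g) :
      (A.X ◁ k.hom ≫ μ[A.X]) ≫ g = (A.X ◁ ε[K.X] ≫ (ρ_ A.X).hom) ≫ g := by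
    have h₁ := congrArg (translation w ≫ ·) hg
    simp only [Category.assoc] at h₁
    rw [← Category.assoc (translation w), ← Category.assoc (translation w), translation_ι,
      ← Category.assoc, ← Category.assoc (pairing _ _), pairing_tensorFst, pairing_tensorSnd,
      ← whiskerLeft_mul_eq_conv] at h₁
    exact h₁.symm
  refine ⟨hcond, ⟨Cofork.IsColimit.mk' _ fun s => ?_⟩⟩
  refine ⟨Cofork.IsColimit.desc hp s.π (hdesc s.π s.condition),
    Cofork.IsColimit.π_desc' hp _ _, fun {m} hm => ?_⟩
  rw [← cancel_epi p.hom]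
  exact Eq.trans hm (Cofork.IsColimit.π_desc' hp _ _).symm

/-- The quotient associated with `k` is the cokernel of `k`. -/
lemma IsQuotientBy.isCokernel [∀ X : M, (tensorLeft X).PreservesEpimorphisms]
    [∀ X : M, (tensorRight X).PreservesEpimorphisms] (w : k ≫ p = 0)
    (h : IsQuotientBy k p.hom) : Nonempty (IsColimit (CokernelCofork.ofπ p w)) := by
  obtain ⟨w', ⟨hp⟩⟩ := h
  have hπ : Epi p.hom := epi_of_isColimit_cofork hp
  have hd (C : HopfCoc M) (g : A ⟶ C) (hg : k ≫ g = 0) : ∃ l : I ⟶ C, p ≫ l = g := by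
    have hg' : k.hom ≫ g.hom = ε[K.X] ≫ η[C.X] := congrArg HopfCoc.Hom.hom hg
    obtain ⟨l, hl⟩ := Cofork.IsColimit.desc' hp g.hom (by
      rw [whiskerLeft_mul_eq_conv, conv_tensorSnd_comp hg']
      rfl)
    change p.hom ≫ l = g.hom at hl
    have : IsBimonHom (p.hom ≫ l) := by rw [hl]; infer_instance
    exact ⟨{ hom := l, isBimonHom := isBimonHom_of_epi_comp p l }, HopfCoc.hom_ext hl⟩
  choose l hl using hd
  refine ⟨CokernelCofork.IsColimit.ofπ _ _ (fun g hg => l _ g hg) (fun g hg => hl _ g hg)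
    fun g hg m hm => HopfCoc.hom_ext ?_⟩
  rw [← cancel_epi p.hom, ← HopfCoc.comp_hom, hm, ← HopfCoc.comp_hom, hl]

end Quotient

/-! ### Consequences of faithful coflatness. -/

section Coflat

variable {M : Type u} [Category.{v} M] [Abelian M] [MonoidalCategory M] [SymmetricCategory M]
  [MonoidalPreadditive M]
  [∀ X : M, PreservesFiniteLimits (tensorLeft X)]
  [∀ X : M, PreservesFiniteLimits (tensorRight X)]
  [∀ X : M, PreservesFiniteColimits (tensorRight X)]

/-- A comodule morphism is a monomorphism of `M` if a functor that reflects epimorphisms turns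
it into a monomorphism, and cotensoring with `W` is such a functor. -/
lemma mono_hom_of_mono_cotensorFunctor_map {Q : M} [ComonObj Q] (W : LeftComod Q)
    [(cotensorFunctor W).ReflectsEpimorphisms] {V V' : RightComod Q} (f : V ⟶ V')
    [Mono ((cotensorFunctor W).map f)] : Mono f.hom := by
  -- The kernel `N` of `f` in `M` is a subcomodule, because tensoring with `Q` preserves it; the aim
  -- is `N = 0`.
  let n := equalizer.ι f.hom 0
  have hn : n ≫ f.hom = 0 := (equalizer.condition _ _).trans comp_zero
  obtain ⟨c, hc⟩ := Fork.IsLimit.lift' (isLimitForkMapOfIsLimit (tensorRight Q)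
    (equalizer.condition f.hom 0) (equalizerIsEqualizer f.hom 0)) (n ≫ V.coact) (by
      change (n ≫ V.coact) ≫ f.hom ▷ Q = (n ≫ V.coact) ≫ (0 : V.X ⟶ V'.X) ▷ Q
      rw [Category.assoc, ← f.hom_coact, reassoc_of% hn, zero_comp,
        MonoidalPreadditive.zero_whiskerRight, comp_zero])
  let N := V.ofMono n c hc
  let ν : N ⟶ V := { hom := n, hom_coact := hc.symm }
  let z : N ⟶ N :=
    { hom := 0, hom_coact := by rw [zero_comp, MonoidalPreadditive.zero_whiskerRight, comp_zero] }
  have hν : (cotensorFunctor W).map ν = 0 := by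
    rw [← cancel_mono ((cotensorFunctor W).map f), ← Functor.map_comp, zero_comp]
    rw [← cancel_mono (cotensorFunctorι W V'), cotensorFunctor_map_ι, zero_comp]
    change _ ≫ (n ≫ f.hom) ▷ W.X = 0
    rw [hn, MonoidalPreadditive.zero_whiskerRight]
    exact comp_zero
  have hN : IsZero ((cotensorFunctor W).obj N) := by
    rw [IsZero.iff_id_eq_zero]
    have : Mono (ν.hom ▷ W.X) := inferInstanceAs (Mono (n ▷ W.X))
    rw [← cancel_mono (cotensorFunctorι W N), ← cancel_mono (ν.hom ▷ W.X), Category.id_comp,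
      ← cotensorFunctor_map_ι, hν, zero_comp, zero_comp, zero_comp]
  -- Reflection yields an epimorphism of comodules only, so it is applied to the zero endomorphism
  -- of `N`: if that is epi, it equals the identity.
  have : Epi ((cotensorFunctor W).map z) := ⟨fun _ _ _ => hN.eq_of_src _ _⟩
  have hz : Epi z := (cotensorFunctor W).epi_of_epi_map this
  have h1 : 𝟙 N = z := by
    rw [← cancel_epi z]
    exact RightComod.Hom.ext ((Category.comp_id _).trans zero_comp.symm)
  have hid : 𝟙 N.X = 0 := congrArg RightComod.Hom.hom h1
  have hn0 : n = 0 := by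
    rw [← Category.id_comp n]
    exact (congrArg (· ≫ n) hid).trans zero_comp
  refine Preadditive.mono_of_cancel_zero _ fun g hg => ?_
  rw [← equalizer.lift_ι g (hg.trans comp_zero.symm)]
  exact (congrArg (_ ≫ ·) hn0).trans comp_zero

/-- Under the faithful coflatness condition, an epimorphism is the quotient associated with its
Hopf kernel. -/
theorem IsHopfKernel.isQuotientBy (hM : FaithfulCoflatnessCondition M) {K A I : HopfCoc M}
    {k : K ⟶ A} {p : A ⟶ I} (h : IsHopfKernel k p) [Epi p.hom] : IsQuotientBy k p.hom := by
  let V := RightComod.ofHom p.hom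
  let W := LeftComod.ofHom p.hom
  have hF := hM A (ModComonCoc.ofHom p) p.hom (ModComonCoc.isModComonHom_ofHom p) ‹Epi p.hom›
  have _ : (cotensorFunctor W).PreservesEpimorphisms := hF.1
  have _ : (cotensorFunctor W).ReflectsEpimorphisms := hF.2
  have hw := conv_tensorSnd_comp h.comp_hom_eq
  obtain ⟨X, q, hq, ⟨hX⟩⟩ : ∃ (X : M) (q : A.X ⟶ X)
      (hq : conv (tensorFst A.X K.X) (tensorSnd A.X K.X ≫ k.hom) ≫ q = tensorFst A.X K.X ≫ q),
      Nonempty (IsColimit (Cofork.ofπ q hq)) :=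
    ⟨_, coequalizer.π _ _, coequalizer.condition _ _, ⟨coequalizerIsCoequalizer _ _⟩⟩
  have hq' : Epi q := epi_of_isColimit_cofork hX
  obtain ⟨j, hj⟩ : ∃ j, q ≫ j = p.hom := ⟨_, Cofork.IsColimit.π_desc' hX p.hom hw⟩
  obtain ⟨c, hc⟩ : ∃ c, q ≫ c = pairing q p.hom :=
    ⟨_, Cofork.IsColimit.π_desc' hX _ (by rw [comp_pairing, comp_pairing, hq, hw])⟩
  have hV : V.coact ≫ q ▷ I.X = pairing q p.hom := by
    change (Δ[A.X] ≫ A.X ◁ p.hom) ≫ q ▷ I.X = _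
    rw [Category.assoc, ← tensorHom_def', pairing]
  let Q : RightComod I.X := @RightComod.ofEpi _ _ _ _ _ V X q hq' c (hc.trans hV.symm)
  let φ : V ⟶ Q := { hom := q, hom_coact := hc.trans hV.symm }
  let ψ : Q ⟶ RightComod.ofHom (𝟙 I.X) :=
    { hom := j
      hom_coact := by
        change j ≫ Δ[I.X] ≫ I.X ◁ 𝟙 I.X = c ≫ j ▷ I.X
        rw [whiskerLeft_id, Category.comp_id, ← cancel_epi q, reassoc_of% hj, reassoc_of% hc,
          pairing_whiskerRight, hj, comp_comul] }
  have hφ : Epi φ.hom := hq'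
  have hφ' : Epi φ := RightComod.epi_of_epi_hom φ
  -- `s` is a ↦ q(a₁) ⊗ a₂; its retraction `r` applies the counit of `I` after `j`.
  let s : A.X ⟶ (cotensorFunctor W).obj Q := cotensorLift Q W
    (show A.X ⟶ X ⊗ A.X from pairing q (𝟙 A.X)) (by
      change pairing q (𝟙 A.X) ≫ c ▷ A.X ≫ (α_ X I.X A.X).hom =
        pairing q (𝟙 A.X) ≫ X ◁ (Δ[A.X] ≫ p.hom ▷ A.X)
      rw [pairing_whiskerRight_assoc, hc, pairing_associator_hom, pairing_whiskerLeft,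
        Category.id_comp, comul_eq_pairing, pairing_whiskerRight, Category.id_comp])
  let e : (cotensorFunctor W).obj Q ⟶ X ⊗ A.X := cotensorFunctorι W Q
  have _ : Mono e := inferInstanceAs (Mono (cotensorFunctorι W Q))
  have hs : s ≫ e = pairing q (𝟙 A.X) := cotensorLift_ι _ _ _ _
  let r : (cotensorFunctor W).obj Q ⟶ A.X := e ≫ (j ≫ ε[I.X]) ▷ A.X ≫ (λ_ A.X).hom
  have hsr : s ≫ r = 𝟙 A.X := by
    rw [reassoc_of% hs, pairing_whiskerRight_assoc, reassoc_of% hj, IsComonHom.hom_counit,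
      pairing_counit_leftUnitor]
  let T : A.X ⊗ K.X ⟶ (cotensorFunctor W).obj V := translation h.comp_hom_eq
  -- Both sides are a ⊗ x ↦ q(a₁x) ⊗ a₂ = q(a₁) ⊗ a₂ ε(x). The left side is epi, hence so is `s`,
  -- and `s` and `r` are mutually inverse.
  have hT : T ≫ (cotensorFunctor W).map φ = tensorFst A.X K.X ≫ s := by
    have hφe : (cotensorFunctor W).map φ ≫ e = cotensorSquareι p.hom ≫ q ▷ A.X :=
      cotensorFunctor_map_ι W φ
    rw [← cancel_mono e, Category.assoc, Category.assoc, hs, hφe]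
    refine (Category.assoc (translation _) _ _).symm.trans ?_
    rw [translation_ι, pairing_whiskerRight, hq, comp_pairing, Category.comp_id]
  have _ : IsSplitEpi T := h.isSplitEpi_translation
  have _ : Epi ((cotensorFunctor W).map φ) := inferInstance
  have _ : Epi (tensorFst A.X K.X ≫ s) := by
    rw [← hT]
    infer_instance
  have _ : Epi s := epi_of_epi (tensorFst A.X K.X) s
  have hrs : r ≫ s = 𝟙 _ := by
    rw [← cancel_epi s, reassoc_of% hsr, Category.comp_id]
  have _ : IsSplitMono r := ⟨⟨⟨s, hrs⟩⟩⟩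
  have hr : (cotensorFunctor W).map ψ ≫ cotensorFunctorι W _ ≫ ε[I.X] ▷ A.X ≫ (λ_ A.X).hom =
      r := by
    refine (cotensorFunctor_map_ι_assoc W ψ _).trans ?_
    change e ≫ j ▷ A.X ≫ ε[I.X] ▷ A.X ≫ (λ_ A.X).hom = _
    rw [← comp_whiskerRight_assoc]
  have _ : Mono ((cotensorFunctor W).map ψ) := mono_of_mono_fac hr
  have _ : Mono j := mono_hom_of_mono_cotensorFunctor_map W ψ
  have _ : Epi j := epi_of_epi_fac hj
  have _ : IsIso j := isIso_of_mono_of_epi j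
  refine ⟨by rw [whiskerLeft_mul_eq_conv]; exact hw, ⟨Cofork.IsColimit.mk' _ fun t => ?_⟩⟩
  have ht : conv (tensorFst A.X K.X) (tensorSnd A.X K.X ≫ k.hom) ≫ t.π =
      tensorFst A.X K.X ≫ t.π := by
    rw [← whiskerLeft_mul_eq_conv]
    exact t.condition
  obtain ⟨l, hl⟩ := Cofork.IsColimit.desc' hX t.π ht
  change q ≫ l = t.π at hl
  have hfac : p.hom ≫ inv j ≫ l = t.π := by
    rw [← hj, Category.assoc, IsIso.hom_inv_id_assoc, hl]
  exact ⟨inv j ≫ l, hfac, fun {m} hm => (cancel_epi p.hom).1 (hm.trans hfac.symm)⟩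

end Coflat

/-! ### Factorization of morphisms of cocommutative Hopf monoids -/

section Factorization

lemma HopfCoc.mono_of_mono_hom {M : Type u} [Category.{v} M] [MonoidalCategory M]
    [BraidedCategory M] {A B : HopfCoc M} (f : A ⟶ B) [Mono f.hom] : Mono f :=
  ⟨fun g h w => HopfCoc.hom_ext <| by
    rw [← cancel_mono f.hom]
    exact congrArg HopfCoc.Hom.hom w⟩

variable {M : Type u} [Category.{v} M] [Abelian M] [MonoidalCategory M] [SymmetricCategory M]
  [MonoidalPreadditive M]
  [∀ X : M, PreservesFiniteLimits (tensorLeft X)]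
  [∀ X : M, PreservesFiniteColimits (tensorLeft X)]
  [∀ X : M, PreservesFiniteLimits (tensorRight X)]
  [∀ X : M, PreservesFiniteColimits (tensorRight X)]

/-- Under the faithful coflatness condition, an epimorphism of `M` is the cokernel of its Hopf
kernel. -/
lemma IsHopfKernel.isCokernel (hM : FaithfulCoflatnessCondition M) {K A I : HopfCoc M}
    {k : K ⟶ A} {p : A ⟶ I} (h : IsHopfKernel k p) [Epi p.hom] :
    Nonempty (IsColimit (CokernelCofork.ofπ p h.comp_eq_zero)) :=
  (h.isQuotientBy hM).isCokernel h.comp_eq_zero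

lemma HopfCoc.nonempty_normalEpi (hM : FaithfulCoflatnessCondition M) {A I : HopfCoc M}
    (p : A ⟶ I) [Epi p.hom] : Nonempty (NormalEpi p) := by
  obtain ⟨K, k, h⟩ := HopfCoc.exists_isHopfKernel p
  exact ⟨⟨K, k, h.comp_eq_zero, (h.isCokernel hM).some⟩⟩

/-- A regular epimorphism of cocommutative Hopf monoids is an epimorphism of `M`. -/
lemma HopfCoc.epi_hom_of_isRegularEpi {A B : HopfCoc M} (f : A ⟶ B) [IsRegularEpi f] :
    Epi f.hom := by
  obtain ⟨I, p, i, _, _, rfl⟩ := HopfCoc.exists_image f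
  -- A regular epimorphism is strong, so `i` is a strong epimorphism as well as a monomorphism.
  have : Mono i := HopfCoc.mono_of_mono_hom i
  have : StrongEpi i := strongEpi_of_strongEpi p i
  have : IsIso i := isIso_of_mono_of_strongEpi i
  have : IsIso i.hom := ⟨(inv i).hom, congrArg HopfCoc.Hom.hom (IsIso.hom_inv_id i),
    congrArg HopfCoc.Hom.hom (IsIso.inv_hom_id i)⟩
  exact epi_comp p.hom i.hom

/-- Under the faithful coflatness condition, monomorphisms of cocommutative Hopf monoids are
monomorphisms of `M`. -/
lemma HopfCoc.mono_hom_of_mono (hM : FaithfulCoflatnessCondition M) {A B : HopfCoc M}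
    (f : A ⟶ B) [Mono f] : Mono f.hom := by
  obtain ⟨I, p, i, _, _, rfl⟩ := HopfCoc.exists_image f
  obtain ⟨K, k, h⟩ := HopfCoc.exists_isHopfKernel p
  have hk : k = 0 := by
    rw [← cancel_mono (p ≫ i), reassoc_of% h.comp_eq_zero, zero_comp, zero_comp]
  -- Since `p` is a cokernel of a zero morphism, the identity of `A` factors through it.
  obtain ⟨l, hl⟩ := CokernelCofork.IsColimit.desc' (h.isCokernel hM).some (𝟙 A)
    (by rw [hk, zero_comp])
  change p ≫ l = 𝟙 A at hl
  have : Mono (p.hom ≫ l.hom) := by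
    rw [← HopfCoc.comp_hom, hl]
    exact inferInstanceAs (Mono (𝟙 A.X))
  have : Mono p.hom := mono_of_mono p.hom l.hom
  exact mono_comp p.hom i.hom

end Factorization

theorem corollary7p2 {M : Type u} [Category.{v} M] [Abelian M] [MonoidalCategory M]
    [SymmetricCategory M] [MonoidalPreadditive M]
    [∀ X : M, PreservesFiniteLimits (tensorLeft X)]
    [∀ X : M, PreservesFiniteColimits (tensorLeft X)]
    [∀ X : M, PreservesFiniteLimits (tensorRight X)]
    [∀ X : M, PreservesFiniteColimits (tensorRight X)]
    (hM : FaithfulCoflatnessCondition M) :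
    -- the factorization of an arbitrary morphism
    (∀ (A B : HopfCoc M) (f : A ⟶ B),
      ∃ (K : HopfCoc M) (k : K ⟶ A) (I : HopfCoc M) (p : A ⟶ I) (i : I ⟶ B),
        -- `k` is the kernel of `f` in `HopfCoc M`
        (∃ w : k ≫ f = 0, Nonempty (IsLimit (KernelFork.ofι k w))) ∧
        -- `p` is the cokernel in `M` of the kernel of `f` in `M`
        (∃ w : kernel.ι f.hom ≫ p.hom = 0, Nonempty (IsColimit (CokernelCofork.ofπ p.hom w))) ∧
        -- `p` is the coequalizer in `M` of the two morphisms from the cotensor square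
        IsCotensorCoequalizer p.hom ∧
        -- `p` is the quotient of `A` associated with `k`
        IsQuotientBy k p.hom ∧
        -- `p` is the cokernel of `k` in `HopfCoc M`
        (∃ w : k ≫ p = 0, Nonempty (IsColimit (CokernelCofork.ofπ p w))) ∧
        -- `f` is the regular epimorphism `p` followed by the monomorphism `i`
        IsRegularEpi p ∧ Mono i ∧ p ≫ i = f) ∧
    -- regular epimorphisms, equivalently cokernels, are the epimorphisms of `M`
    (∀ (A B : HopfCoc M) (f : A ⟶ B),
      (IsRegularEpi f ↔ Nonempty (NormalEpi f)) ∧ (IsRegularEpi f ↔ Epi f.hom)) ∧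
    -- monomorphisms are the monomorphisms of `M`
    (∀ (A B : HopfCoc M) (f : A ⟶ B), Mono f ↔ Mono f.hom) := by
  refine ⟨fun A B f => ?_, fun A B f => ⟨⟨fun _ => ?_, fun ⟨_⟩ => inferInstance⟩,
    fun _ => HopfCoc.epi_hom_of_isRegularEpi f, fun _ => ?_⟩,
    fun A B f => ⟨fun _ => HopfCoc.mono_hom_of_mono hM f, fun _ => HopfCoc.mono_of_mono_hom f⟩⟩
  · obtain ⟨I, p, i, hp, hi, rfl⟩ := HopfCoc.exists_image f
    -- The kernel is taken of the epi part `p`, where coflatness applies; as `i` is mono, it is also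
    -- the kernel of `p ≫ i`.
    obtain ⟨K, k, h⟩ := HopfCoc.exists_isHopfKernel p
    have hq := h.isQuotientBy hM
    obtain ⟨hn⟩ := HopfCoc.nonempty_normalEpi hM p
    have hi' : Mono i := HopfCoc.mono_of_mono_hom i
    have hw : kernel.ι (p ≫ i).hom ≫ p.hom = 0 := by
      rw [← cancel_mono i.hom, Category.assoc, ← HopfCoc.comp_hom, kernel.condition, zero_comp]
    have hker : IsLimit (KernelFork.ofι (kernel.ι (p ≫ i).hom) hw) :=
      isKernelOfComp i.hom (p ≫ i).hom (kernelIsKernel _) hw rfl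
    exact ⟨K, k, I, p, i,
      ⟨by rw [reassoc_of% h.comp_eq_zero, zero_comp], ⟨isKernelCompMono h.isKernel.some i rfl⟩⟩,
      ⟨hw, ⟨Abelian.epiIsCokernelOfKernel _ hker⟩⟩, hq.isCotensorCoequalizer h.comp_hom_eq, hq,
      ⟨h.comp_eq_zero, h.isCokernel hM⟩, inferInstance, hi', rfl⟩
  · have := HopfCoc.epi_hom_of_isRegularEpi f
    exact HopfCoc.nonempty_normalEpi hM f
  · obtain ⟨_⟩ := HopfCoc.nonempty_normalEpi hM f
    infer_instance
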